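/- Let $n\ge 2$, let $E$ be the antidiagonal $2n\times 2n$ matrix with all antidiagonal entries $1$, and let $\mathrm{SO}_{2n}=\{g\in \mathrm{SL}_{2n}(\mathbb C): (g^t)^{-1}=EgE^{-1}\}$, with Borel subgroup its upper triangular elements and maximal torus $T=\{\mathbf t=\mathrm{diag}(t_1,\dots,t_n,t_n^{-1},\dots,t_1^{-1}): t_i\in\mathbb C^*\}$. Let $\omega_1,\dots,\omega_n$ be the fundamental weights of type $D_n$ in Bourbaki's numbering, so that $2\omega_n$ and $2\omega_{n-1}$ are the characters $t_1\cdots t_n$ and $t_1\cdots t_{n-1}t_n^{-1}$ of $T$. For a dominant character $\lambda$ of $T$ let $V(\lambda)$ be the irreducible finite dimensional rational representation of $\mathrm{SO}_{2n}$ with highest weight $\lambda$. Then the function $\mathbf t\mapsto\prod_{i=1}^n (t_i-t_i^{-1})$ on $T$ is the character of the virtual representation $[V(2\omega_n)]-[V(2\omega_{n-1})]$, that is, $$\operatorname{tr}\bigl(\mathbf t\mid V(2\omega_n)\bigr)-\operatorname{tr}\bigl(\mathbf t\mid V(2\omega_{n-1})\bigr)=\prod_{i=1}^n (t_i-t_i^{-1})\qquad\text{for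 all }\mathbf t\in T.$$ Moreover, $\Lambda^n(\mathbb C^{2n})$ is, as a representation of $\mathrm{SO}_{2n}$, the direct sum of two irreducible subrepresentations, one isomorphic to $V(2\omega_n)$ and the other to $V(2\omega_{n-1})$. -/

import Mathlib

universe u v

open scoped Matrix

noncomputable section

namespace SOEven

/-- The antidiagonal `2n × 2n` matrix with all antidiagonal entries `1`. -/
def formMatrix (n : ℕ) : Matrix (Fin (2 * n)) (Fin (2 * n)) ℂ :=
  Matrix.of fun i j => if j = Fin.rev i then 1 else 0

theorem formMatrix_mul_self (n : ℕ) : formMatrix n * formMatrix n = 1 := by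
  ext i j
  rw [Matrix.mul_apply, Finset.sum_eq_single (Fin.rev i)]
  · simp [formMatrix, Matrix.one_apply, eq_comm]
  · intro k _ hk
    simp [formMatrix, hk]
  · simp

theorem formMatrix_inv (n : ℕ) : (formMatrix n)⁻¹ = formMatrix n :=
  Matrix.inv_eq_left_inv (formMatrix_mul_self n)

/-- The defining condition of the group, with the inverses cleared. -/
theorem transpose_inv_eq_iff {n : ℕ} (g : Matrix.SpecialLinearGroup (Fin (2 * n)) ℂ) :
    ((g.1)ᵀ)⁻¹ = formMatrix n * g.1 * (formMatrix n)⁻¹ ↔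
      (g.1)ᵀ * formMatrix n * g.1 = formMatrix n := by
  have hE := formMatrix_mul_self n
  have hdet : IsUnit ((g.1)ᵀ).det := by
    rw [Matrix.det_transpose, g.2]; exact isUnit_one
  rw [formMatrix_inv]
  constructor
  · intro h
    have h2 : (g.1)ᵀ * (formMatrix n * g.1 * formMatrix n) = 1 := by
      rw [← h]; exact Matrix.mul_nonsing_inv _ hdet
    calc (g.1)ᵀ * formMatrix n * g.1
        = (g.1)ᵀ * (formMatrix n * g.1 * formMatrix n) * formMatrix n := by
          simp only [Matrix.mul_assoc, hE, Matrix.mul_one]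
      _ = formMatrix n := by rw [h2, Matrix.one_mul]
  · intro h
    apply Matrix.inv_eq_right_inv
    calc (g.1)ᵀ * (formMatrix n * g.1 * formMatrix n)
        = ((g.1)ᵀ * formMatrix n * g.1) * formMatrix n := by
          simp only [Matrix.mul_assoc]
      _ = 1 := by rw [h, hE]

/-- The complex group `SO_{2n} = {g ∈ SL_{2n} : (gᵗ)⁻¹ = E g E⁻¹}`, where `E` is the antidiagonal
matrix with all antidiagonal entries `1`. -/
def SO (n : ℕ) : Subgroup (Matrix.SpecialLinearGroup (Fin (2 * n)) ℂ) where
  carrier := {g | ((g.1)ᵀ)⁻¹ = formMatrix n * g.1 * (formMatrix n)⁻¹}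
  mul_mem' := by
    intro a b ha hb
    rw [Set.mem_ofPred_eq, transpose_inv_eq_iff] at ha hb ⊢
    calc (a.1 * b.1)ᵀ * formMatrix n * (a.1 * b.1)
        = (b.1)ᵀ * ((a.1)ᵀ * formMatrix n * a.1) * b.1 := by
          simp only [Matrix.transpose_mul, Matrix.mul_assoc]
      _ = formMatrix n := by rw [ha, hb]
  one_mem' := by
    rw [Set.mem_ofPred_eq, transpose_inv_eq_iff]
    simp
  inv_mem' := by
    intro a ha
    rw [Set.mem_ofPred_eq, transpose_inv_eq_iff] at ha ⊢
    have h1 : a.1 * (a⁻¹).1 = 1 := by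
      rw [← Matrix.SpecialLinearGroup.coe_mul, mul_inv_cancel, Matrix.SpecialLinearGroup.coe_one]
    have h2 : ((a⁻¹).1)ᵀ * (a.1)ᵀ = 1 := by
      rw [← Matrix.transpose_mul, h1, Matrix.transpose_one]
    calc ((a⁻¹).1)ᵀ * formMatrix n * (a⁻¹).1
        = ((a⁻¹).1)ᵀ * ((a.1)ᵀ * formMatrix n * a.1) * (a⁻¹).1 := by rw [ha]
      _ = (((a⁻¹).1)ᵀ * (a.1)ᵀ) * formMatrix n * (a.1 * (a⁻¹).1) := by
          simp only [Matrix.mul_assoc]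
      _ = formMatrix n := by rw [h1, h2, Matrix.one_mul, Matrix.mul_one]

/-- The underlying matrix of an element of `SO_{2n}`. -/
def mat {n : ℕ} (g : SO n) : Matrix (Fin (2 * n)) (Fin (2 * n)) ℂ := g.1.1

/-- The index of the diagonal entry `t_i` (as opposed to `t_i⁻¹`) of a torus element. -/
def firstHalf {n : ℕ} (i : Fin n) : Fin (2 * n) := ⟨i.1, by omega⟩

/-- The sequence `(t_1, …, t_n, t_n⁻¹, …, t_1⁻¹)`. -/
def torusEntry {n : ℕ} (t : Fin n → ℂˣ) (i : Fin (2 * n)) : ℂˣ :=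
  if h : i.1 < n then t ⟨i.1, h⟩ else (t ⟨(Fin.rev i).1, by rw [Fin.val_rev]; omega⟩)⁻¹

theorem torusEntry_mul_rev {n : ℕ} (t : Fin n → ℂˣ) (i : Fin (2 * n)) :
    torusEntry t i * torusEntry t (Fin.rev i) = 1 := by
  unfold torusEntry
  by_cases h : i.1 < n
  · have h' : ¬ (Fin.rev i).1 < n := by rw [Fin.val_rev]; omega
    simp only [dif_pos h, dif_neg h', Fin.rev_rev, mul_inv_cancel]
  · have h' : (Fin.rev i).1 < n := by rw [Fin.val_rev]; omega
    simp only [dif_pos h', dif_neg h, inv_mul_cancel]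

theorem prod_torusEntry {n : ℕ} (t : Fin n → ℂˣ) : ∏ i, torusEntry t i = 1 := by
  refine Finset.prod_involution (fun i _ => Fin.rev i) (fun i _ => torusEntry_mul_rev t i)
    (fun i _ _ h => ?_) (fun i _ => Finset.mem_univ _) (fun i _ => Fin.rev_rev i)
  have := congrArg Fin.val h
  rw [Fin.val_rev] at this
  omega

/-- The element `diag(t_1, …, t_n, t_n⁻¹, …, t_1⁻¹)` of the maximal torus of `SO_{2n}`. -/
def torusElt {n : ℕ} (t : Fin n → ℂˣ) : SO n :=
  ⟨⟨Matrix.diagonal fun i => (torusEntry t i : ℂ), by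
      rw [Matrix.det_diagonal, ← Units.coe_prod, prod_torusEntry, Units.val_one]⟩, by
    refine (transpose_inv_eq_iff _).mpr ?_
    ext i j
    simp only [Matrix.diagonal_transpose, Matrix.mul_diagonal, Matrix.diagonal_mul, formMatrix,
      Matrix.of_apply]
    split_ifs with h
    · subst h
      rw [mul_one, ← Units.val_mul, torusEntry_mul_rev, Units.val_one]
    · simp⟩

/-- The standard Borel subgroup of `SO_{2n}`: its upper triangular elements. -/
def IsBorel {n : ℕ} (b : SO n) : Prop := ∀ i j, j < i → mat b i j = 0

/-- The value at `b` in the Borel subgroup of the character `t_1 ^ d_1 ⋯ t_n ^ d_n` of the torus,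
extended to the Borel subgroup. -/
def borelCharacter {n : ℕ} (d : Fin n → ℤ) (b : SO n) : ℂ :=
  ∏ i, (mat b (firstHalf i) (firstHalf i)) ^ d i

/-- The fundamental weights of type `D_n` in Bourbaki's numbering, in the coordinates
`ε_1, …, ε_n` of `𝔱*`; the index `j : Fin n` stands for `j + 1`. A character
`t_1 ^ d_1 ⋯ t_n ^ d_n` of the torus is the weight `d_1 ε_1 + ⋯ + d_n ε_n`. -/
def fundamentalWeight (n : ℕ) (j : Fin n) : Fin n → ℚ := fun k =>
  if j.1 + 1 = n then 1 / 2
  else if j.1 + 2 = n then (if k.1 + 1 = n then -(1 / 2) else 1 / 2)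
  else if k.1 ≤ j.1 then 1 else 0

/-- The pairing of a weight with the `j`-th simple coroot: the simple coroots are
`ε_j - ε_{j+1}` for `j < n` and `ε_{n-1} + ε_n` for `j = n` (one-based numbering). -/
def corootPairing {n : ℕ} (hn : 2 ≤ n) (μ : Fin n → ℚ) (j : Fin n) : ℚ :=
  if h : j.1 + 1 < n then μ j - μ ⟨j.1 + 1, h⟩
  else μ ⟨n - 2, by omega⟩ + μ ⟨n - 1, by omega⟩

/-- The fundamental weights are dual to the simple coroots. -/
theorem corootPairing_fundamentalWeight {n : ℕ} (hn : 2 ≤ n) (i j : Fin n) :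
    corootPairing hn (fundamentalWeight n i) j = if i = j then 1 else 0 := by
  obtain ⟨i, hi⟩ := i
  obtain ⟨j, hj⟩ := j
  simp only [corootPairing, fundamentalWeight, Fin.mk.injEq]
  split_ifs <;> first | omega | norm_num

/-- A representation of `SO_{2n}` is rational (algebraic) if all its matrix coefficients are regular
functions on the group, i.e. restrictions of polynomials in the matrix entries. -/
def IsRational {n : ℕ} {V : Type u} [AddCommGroup V] [Module ℂ V]
    (ρ : Representation ℂ (SO n) V) : Prop :=
  ∀ (φ : Module.Dual ℂ V) (x : V), ∃ P : MvPolynomial (Fin (2 * n) × Fin (2 * n)) ℂ,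
    ∀ g : SO n, φ (ρ g x) = MvPolynomial.eval (fun ij => mat g ij.1 ij.2) P

/-- `ρ` has a highest weight vector of weight `μ`: the weight `μ ∈ 𝔱*` is a character of the
torus, and there is a nonzero vector on which the Borel subgroup acts through that character. -/
def HasHighestWeight {n : ℕ} {V : Type u} [AddCommGroup V] [Module ℂ V]
    (ρ : Representation ℂ (SO n) V) (μ : Fin n → ℚ) : Prop :=
  ∃ d : Fin n → ℤ, (∀ i, (d i : ℚ) = μ i) ∧
    ∃ x : V, x ≠ 0 ∧ ∀ b : SO n, IsBorel b → ρ b x = borelCharacter d b • x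

/-- `ρ` is the irreducible representation `V(μ)` of `SO_{2n}`: a finite dimensional irreducible
rational representation with highest weight `μ`. -/
structure IsIrrepOfHighestWeight {n : ℕ} {V : Type u} [AddCommGroup V] [Module ℂ V]
    (ρ : Representation ℂ (SO n) V) (μ : Fin n → ℚ) : Prop where
  finite : Module.Finite ℂ V
  rational : IsRational ρ
  irreducible : ρ.IsIrreducible
  highest : HasHighestWeight ρ μ

/-- The standard representation of `SO_{2n}` on `ℂ^{2n}`. -/
def standardRep (n : ℕ) : Representation ℂ (SO n) (Fin (2 * n) → ℂ) where
  toFun g := Matrix.toLin' (mat g)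
  map_one' := Matrix.toLin'_one
  map_mul' g h := Matrix.toLin'_mul (mat g) (mat h)

/-- The representation of `SO_{2n}` on the exterior power `Λ^k(ℂ^{2n})`. -/
def exteriorRep (n k : ℕ) : Representation ℂ (SO n) (⋀[ℂ]^k (Fin (2 * n) → ℂ)) where
  toFun g := exteriorPower.map k (standardRep n g)
  map_one' := by
    rw [map_one]
    exact exteriorPower.map_id
  map_mul' g h := by
    rw [map_mul]
    exact exteriorPower.map_comp (standardRep n h) (standardRep n g)

end SOEven

end

open SOEven

/-! Write i' for the index opposite to i. The vectors x₊ = e_1 ∧ ⋯ ∧ e_n and x₋ = e_1 ∧ ⋯ ∧ e_{n-1}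
∧ e_{n+1} are eigenvectors of the Borel subgroup of weights 2ω_n and 2ω_{n-1}; let P₊ and P₋ be the
subrepresentations they generate. The reflection R_i exchanging e_i and e_{i'} preserves the form,
has determinant -1, normalises SO_{2n} and interchanges P₊ and P₋. So P₊ + P₋ is stable under
SO_{2n} and all R_i, and root elements then show that it is all of Λ^n (`eq_top_of_stable`).

The highest weight theory is obtained on the group itself. Let x be a Borel eigenvector of character
χ in a rational representation. Its orbit lies in the span of its lower unipotent orbit
(`orbit_mem_span_lowerUnipotent`): a matrix coefficient that vanishes on the big cell vanishes along
Cayley paths by analytic continuation, and the elements reached by these paths generate SO_{2n}.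
Powers of a = diag(2^n, …, 2, 1/2, …, 2^{-n}) contract lower unipotent elements to 1, so χ(a)^{-k}
a^k v tends weakly to a multiple of x for every v generated by x
(`exists_tendsto_of_mem_span_orbit`). This limit shows that a highest weight determines an
irreducible rational representation (`exists_equiv_of_highestWeight`), that x₊ is orthogonal to P₋,
and that P₊ is irreducible; reflections give the same with signs exchanged. Hence Λ^n = P₊ ⊕ P₋.

For the character, let s be 1 on P₊ and -1 on P₋; the difference of the characters at t is the trace
of t ∘ s on Λ^n. Each R_i anticommutes with s. If a basis vector e_I misses an opposite pair, the
corresponding reflection fixes e_I and its diagonal entry is 0. Otherwise I takes one index from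
each pair, the second one for i in a set U; then |U| reflections carry x₊ to ± e_I, so s e_I =
(-1)^{|U|} e_I. Its contribution is the term of the expansion of ∏ (t_i - t_i⁻¹) indexed by U. -/

noncomputable section

namespace SOEven

/-! ### Triangular factorisation and the big cell -/

/-- A square matrix whose leading principal minors are all nonzero is the product of a lower
unitriangular and an upper triangular matrix. -/
theorem exists_eq_lower_mul_upper {K : Type*} [Field K] :
    ∀ (m : ℕ) (g : Matrix (Fin m) (Fin m) K),
      (∀ (k : ℕ) (hk : k ≤ m), (g.submatrix (Fin.castLE hk) (Fin.castLE hk)).det ≠ 0) →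
      ∃ l u : Matrix (Fin m) (Fin m) K, (∀ i, l i i = 1) ∧ (∀ i j, i < j → l i j = 0) ∧
        (∀ i j, j < i → u i j = 0) ∧ g = l * u := by
  intro m
  induction m with
  | zero =>
    intro g _
    exact ⟨1, 1, fun i => i.elim0, fun i => i.elim0, fun i => i.elim0, by ext i; exact i.elim0⟩
  | succ m ih =>
    intro g hg
    set A := g.submatrix (Fin.castSucc (n := m)) (Fin.castSucc (n := m)) with hA
    obtain ⟨L, U, hL1, hL, hU, hLU⟩ := ih A (fun k hk => hg k (hk.trans (Nat.le_succ m)))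
    have hdet : A.det ≠ 0 := hg m (Nat.le_succ m)
    rw [hLU, Matrix.det_mul] at hdet
    have hLd : IsUnit L.det := (left_ne_zero_of_mul hdet).isUnit
    have hUd : IsUnit U.det := (right_ne_zero_of_mul hdet).isUnit
    -- Bordering: the new row of `l` and column of `u` solve r U = (last row) and L q = (last
    -- column); the corner of `u` is the Schur complement, which may vanish.
    set r : Fin m → K := (fun j => g (Fin.last m) j.castSucc) ᵥ* U⁻¹ with hr
    set q : Fin m → K := L⁻¹ *ᵥ (fun i => g i.castSucc (Fin.last m)) with hq
    have hrU : r ᵥ* U = fun j => g (Fin.last m) j.castSucc := by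
      rw [hr, Matrix.vecMul_vecMul, Matrix.nonsing_inv_mul _ hUd, Matrix.vecMul_one]
    have hLq : L *ᵥ q = fun i => g i.castSucc (Fin.last m) := by
      rw [hq, Matrix.mulVec_mulVec, Matrix.mul_nonsing_inv _ hLd, Matrix.one_mulVec]
    let l : Matrix (Fin (m + 1)) (Fin (m + 1)) K := Matrix.of fun i j =>
      Fin.lastCases (motive := fun _ => K) (Fin.snoc (α := fun _ => K) r 1 j)
        (fun i' => Fin.snoc (α := fun _ => K) (L i') 0 j) i
    let u : Matrix (Fin (m + 1)) (Fin (m + 1)) K := Matrix.of fun i j =>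
      Fin.lastCases (motive := fun _ => K)
        (Fin.snoc (α := fun _ => K) 0 (g (Fin.last m) (Fin.last m) - r ⬝ᵥ q) j)
        (fun i' => Fin.snoc (α := fun _ => K) (U i') (q i') j) i
    refine ⟨l, u, ?_, ?_, ?_, ?_⟩
    · intro i
      induction i using Fin.lastCases with
      | last => simp [l]
      | cast i => simp [l, hL1]
    · intro i j hij
      induction i using Fin.lastCases with
      | last => exact absurd hij (Fin.le_last j).not_gt
      | cast i =>
        induction j using Fin.lastCases with
        | last => simp [l]
        | cast j => simpa [l] using hL i j (by simpa using hij)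
    · intro i j hij
      induction j using Fin.lastCases with
      | last => exact absurd hij (Fin.le_last i).not_gt
      | cast j =>
        induction i using Fin.lastCases with
        | last => simp [u]
        | cast i => simpa [u] using hU i j (by simpa using hij)
    · ext i j
      rw [Matrix.mul_apply, Fin.sum_univ_castSucc]
      induction i using Fin.lastCases with
      | last =>
        induction j using Fin.lastCases with
        | last => simp [l, u, dotProduct]
        | cast j => simpa [l, u, Matrix.vecMul, dotProduct] using (congrFun hrU j).symm
      | cast i =>
        induction j using Fin.lastCases with
        | last => simpa [l, u, Matrix.mulVec, dotProduct] using (congrFun hLq i).symm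
        | cast j => simpa [l, u, hA, Matrix.mul_apply] using congrFun (congrFun hLU i) j

theorem mat_injective {n : ℕ} : Function.Injective (mat (n := n)) :=
  fun _ _ h => Subtype.ext (Subtype.ext h)

@[simp]
theorem mat_mul {n : ℕ} (g h : SO n) : mat (g * h) = mat g * mat h := rfl

@[simp]
theorem mat_one {n : ℕ} : mat (1 : SO n) = 1 := rfl

theorem det_mat {n : ℕ} (g : SO n) : (mat g).det = 1 := g.1.2

theorem transpose_mul_formMatrix_mul {n : ℕ} (g : SO n) :
    (mat g)ᵀ * formMatrix n * mat g = formMatrix n :=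
  (transpose_inv_eq_iff g.1).mp g.2

/-- The element of `SO_{2n}` given by a matrix of determinant one that preserves the form. -/
def ofMatrix {n : ℕ} (M : Matrix (Fin (2 * n)) (Fin (2 * n)) ℂ) (hdet : M.det = 1)
    (hM : Mᵀ * formMatrix n * M = formMatrix n) : SO n :=
  ⟨⟨M, hdet⟩, (transpose_inv_eq_iff _).mpr hM⟩

@[simp]
theorem mat_ofMatrix {n : ℕ} (M : Matrix (Fin (2 * n)) (Fin (2 * n)) ℂ) (hdet : M.det = 1)
    (hM : Mᵀ * formMatrix n * M = formMatrix n) : mat (ofMatrix M hdet hM) = M := rfl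

theorem formMatrix_mul_apply {n : ℕ} (M : Matrix (Fin (2 * n)) (Fin (2 * n)) ℂ)
    (i j : Fin (2 * n)) : (formMatrix n * M) i j = M (Fin.rev i) j := by
  rw [Matrix.mul_apply, Finset.sum_eq_single (Fin.rev i)]
  · simp [formMatrix]
  · intro k _ hk
    simp [formMatrix, hk]
  · simp

theorem mul_formMatrix_apply {n : ℕ} (M : Matrix (Fin (2 * n)) (Fin (2 * n)) ℂ)
    (i j : Fin (2 * n)) : (M * formMatrix n) i j = M i (Fin.rev j) := by
  rw [Matrix.mul_apply, Finset.sum_eq_single (Fin.rev j)]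
  · simp [formMatrix]
  · intro k _ hk
    have : j ≠ Fin.rev k := fun h => hk (by rw [h, Fin.rev_rev])
    simp [formMatrix, this]
  · simp

theorem formMatrix_transpose (n : ℕ) : (formMatrix n)ᵀ = formMatrix n := by
  ext i j
  simp only [formMatrix, Matrix.transpose_apply, Matrix.of_apply]
  congr 1
  exact propext ⟨fun h => by rw [h, Fin.rev_rev], fun h => by rw [h, Fin.rev_rev]⟩

theorem det_formMatrix_ne_zero (n : ℕ) : (formMatrix n).det ≠ 0 := by
  intro h
  have := congrArg Matrix.det (formMatrix_mul_self n)
  rw [Matrix.det_mul, h, Matrix.det_one] at this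
  simp at this

/-- The transpose of an element of `SO_{2n}`. -/
def transposeElt {n : ℕ} (g : SO n) : SO n :=
  ofMatrix (mat g)ᵀ (by rw [Matrix.det_transpose, det_mat]) (by
    have h := transpose_mul_formMatrix_mul g
    have hE := formMatrix_mul_self n
    have h1 : (formMatrix n * (mat g)ᵀ * formMatrix n) * mat g = 1 := by
      simp only [Matrix.mul_assoc] at h ⊢
      rw [h, hE]
    have h2 := mul_eq_one_comm.mp h1
    calc ((mat g)ᵀ)ᵀ * formMatrix n * (mat g)ᵀ
        = mat g * (formMatrix n * (mat g)ᵀ * formMatrix n) * formMatrix n := by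
          simp only [Matrix.transpose_transpose, Matrix.mul_assoc, hE, Matrix.mul_one]
      _ = formMatrix n := by rw [h2, Matrix.one_mul])

@[simp]
theorem mat_transposeElt {n : ℕ} (g : SO n) : mat (transposeElt g) = (mat g)ᵀ := rfl

theorem isUpperTriangular_mul_diag {m : ℕ} {A B : Matrix (Fin m) (Fin m) ℂ}
    (hA : ∀ i j, j < i → A i j = 0) (hB : ∀ i j, j < i → B i j = 0) (i : Fin m) :
    (A * B) i i = A i i * B i i := by
  rw [Matrix.mul_apply, Finset.sum_eq_single i]
  · intro j _ hj
    rcases lt_or_gt_of_ne hj with h | h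
    · rw [hA i j h, zero_mul]
    · rw [hB j i h, mul_zero]
  · simp

theorem isUpperTriangular_mul {m : ℕ} {A B : Matrix (Fin m) (Fin m) ℂ}
    (hA : ∀ i j, j < i → A i j = 0) (hB : ∀ i j, j < i → B i j = 0) (i j : Fin m) (hij : j < i) :
    (A * B) i j = 0 := by
  rw [Matrix.mul_apply]
  refine Finset.sum_eq_zero fun k _ => ?_
  rcases lt_or_ge k i with h | h
  · rw [hA i k h, zero_mul]
  · rw [hB k j (hij.trans_le h), mul_zero]

/-- Lower unitriangular elements of `SO_{2n}`. -/
def IsLowerUnipotent {n : ℕ} (l : SO n) : Prop :=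
  (∀ i, mat l i i = 1) ∧ ∀ i j, i < j → mat l i j = 0

/-- An element of `SO_{2n}` with nonzero leading principal minors lies in the big cell. -/
theorem exists_eq_lowerUnipotent_mul_borel {n : ℕ} (g : SO n)
    (hg : ∀ (k : ℕ) (hk : k ≤ 2 * n),
      ((mat g).submatrix (Fin.castLE hk) (Fin.castLE hk)).det ≠ 0) :
    ∃ l b : SO n, IsLowerUnipotent l ∧ IsBorel b ∧ g = l * b := by
  obtain ⟨l, u, hl1, hl, hu, hlu⟩ := exists_eq_lower_mul_upper _ _ hg
  have hE := formMatrix_mul_self n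
  have hdl : l.det = 1 := by
    rw [Matrix.det_of_isLowerTriangular l fun i j h => hl i j h]
    simp [hl1]
  have hdu : u.det = 1 := by
    have := det_mat g
    rwa [hlu, Matrix.det_mul, hdl, one_mul] at this
  have hui : u * u⁻¹ = 1 := Matrix.mul_nonsing_inv _ (by rw [hdu]; exact isUnit_one)
  have hui' : ∀ i j, j < i → u⁻¹ i j = 0 := by
    have : Invertible u := Matrix.invertibleOfIsUnitDet _ (by rw [hdu]; exact isUnit_one)
    have h := Matrix.blockTriangular_inv_of_blockTriangular (M := u) (b := id)
      fun i j h => hu i j h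
    exact fun i j hij => h hij
  have hgg := transpose_mul_formMatrix_mul g
  rw [hlu, Matrix.transpose_mul] at hgg
  have huit : (u⁻¹)ᵀ * uᵀ = 1 := by rw [← Matrix.transpose_mul, hui, Matrix.transpose_one]
  have key : lᵀ * formMatrix n * l = (u⁻¹)ᵀ * formMatrix n * u⁻¹ := by
    calc lᵀ * formMatrix n * l
        = ((u⁻¹)ᵀ * uᵀ) * (lᵀ * formMatrix n * l) * (u * u⁻¹) := by
          rw [huit, hui, Matrix.one_mul, Matrix.mul_one]
      _ = (u⁻¹)ᵀ * (uᵀ * lᵀ * formMatrix n * (l * u)) * u⁻¹ := by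
          simp only [Matrix.mul_assoc]
      _ = (u⁻¹)ᵀ * formMatrix n * u⁻¹ := by rw [hgg]
  have hrev : ∀ (M : Matrix (Fin (2 * n)) (Fin (2 * n)) ℂ) i j,
      (formMatrix n * Mᵀ * formMatrix n) i j = M (Fin.rev j) (Fin.rev i) := fun M i j => by
    rw [mul_formMatrix_apply, formMatrix_mul_apply, Matrix.transpose_apply]
  have hN : formMatrix n * lᵀ * formMatrix n * l
      = formMatrix n * (u⁻¹)ᵀ * formMatrix n * u⁻¹ := by
    simpa only [Matrix.mul_assoc] using congrArg (formMatrix n * ·) key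
  -- Reversed transposition M ↦ E Mᵀ E keeps triangularity. Thus the left side of `hN` is lower
  -- unitriangular and the right side upper triangular, and both are 1.
  have hlow : (formMatrix n * lᵀ * formMatrix n * l) = 1 := by
    ext i j
    have hT : (formMatrix n * lᵀ * formMatrix n * l) i j
        = (lᵀ * (formMatrix n * lᵀ * formMatrix n)ᵀ) j i := by
      rw [← Matrix.transpose_mul, Matrix.transpose_apply]
    have hup1 : ∀ i j, j < i → lᵀ i j = 0 := fun i j h => hl j i h
    have hup2 : ∀ i j, j < i → (formMatrix n * lᵀ * formMatrix n)ᵀ i j = 0 := fun i j h => by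
      rw [Matrix.transpose_apply, hrev]
      exact hl _ _ (Fin.rev_lt_rev.mpr h)
    rcases lt_trichotomy i j with h | rfl | h
    · rw [hT, isUpperTriangular_mul hup1 hup2 _ _ h, Matrix.one_apply_ne h.ne]
    · rw [hT, isUpperTriangular_mul_diag hup1 hup2, Matrix.transpose_apply, Matrix.transpose_apply,
        hrev, hl1, hl1, Matrix.one_apply_eq, one_mul]
    · rw [hN, Matrix.one_apply_ne h.ne']
      refine isUpperTriangular_mul (fun i j h => ?_) hui' i j h
      rw [hrev]
      exact hui' _ _ (Fin.rev_lt_rev.mpr h)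
  have hlE : lᵀ * formMatrix n * l = formMatrix n := by
    calc lᵀ * formMatrix n * l
        = formMatrix n * (formMatrix n * lᵀ * formMatrix n * l) := by
          simp only [← Matrix.mul_assoc, hE, Matrix.one_mul]
      _ = formMatrix n := by rw [hlow, Matrix.mul_one]
  have huE : uᵀ * formMatrix n * u = formMatrix n := by
    calc uᵀ * formMatrix n * u = uᵀ * (lᵀ * formMatrix n * l) * u := by rw [hlE]
      _ = uᵀ * lᵀ * formMatrix n * (l * u) := by simp only [Matrix.mul_assoc]
      _ = formMatrix n := hgg
  exact ⟨ofMatrix l hdl hlE, ofMatrix u hdu huE, ⟨hl1, hl⟩, hu, mat_injective hlu⟩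

/-! ### Generation by elements without eigenvalue -1 -/

/-- Invariance of the form gives Mᵀ E (1 + M) = (1 + M)ᵀ E; taking determinants, det(1 + M) cancels.
Cayley transforms and root elements are thereby placed in the special group. -/
theorem det_eq_one_of_det_one_add_ne_zero {n : ℕ} {M : Matrix (Fin (2 * n)) (Fin (2 * n)) ℂ}
    (hM : Mᵀ * formMatrix n * M = formMatrix n) (h : (1 + M).det ≠ 0) : M.det = 1 := by
  have h1 : Mᵀ * formMatrix n * (1 + M) = (1 + M)ᵀ * formMatrix n := by
    rw [Matrix.mul_add, hM, Matrix.mul_one, Matrix.transpose_add, Matrix.transpose_one,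
      Matrix.add_mul, Matrix.one_mul, add_comm]
  have h2 := congrArg Matrix.det h1
  rw [Matrix.det_mul, Matrix.det_mul, Matrix.det_mul, Matrix.det_transpose,
    Matrix.det_transpose] at h2
  have h3 : ((formMatrix n).det * (1 + M).det) * M.det = ((formMatrix n).det * (1 + M).det) * 1 := by
    linear_combination h2
  exact mul_left_cancel₀ (mul_ne_zero (det_formMatrix_ne_zero n) h) h3

/-- Adding a suitable diagonal matrix of signs makes any matrix invertible. -/
theorem exists_sign_det_diagonal_add_ne_zero {m : ℕ} (A : Matrix (Fin m) (Fin m) ℂ) :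
    ∃ s : Finset (Fin m), (Matrix.diagonal (fun i => if i ∈ s then (-1 : ℂ) else 1) + A).det ≠ 0 := by
  by_contra! hcon
  -- Average against the product of the signs: in the Leibniz expansion each factor becomes ∑ x (x δ
  -- + a) over x = ±1, which is 2δ, so only the identity permutation survives and the sum is 2^m.
  have h0 : ∑ e ∈ Fintype.piFinset (fun _ : Fin m => ({1, -1} : Finset ℂ)),
      (∏ i, e i) * (Matrix.diagonal e + A).det = 0 := by
    refine Finset.sum_eq_zero fun e he => ?_
    have : e = fun i => if i ∈ Finset.univ.filter (fun i => e i = -1) then (-1 : ℂ) else 1 := by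
      funext i
      have := Fintype.mem_piFinset.mp he i
      simp only [Finset.mem_insert, Finset.mem_singleton] at this
      rcases this with h | h <;> norm_num [h]
    rw [this, hcon, mul_zero]
  have h1 : ∑ e ∈ Fintype.piFinset (fun _ : Fin m => ({1, -1} : Finset ℂ)),
      (∏ i, e i) * (Matrix.diagonal e + A).det
      = ∑ σ : Equiv.Perm (Fin m), (Equiv.Perm.sign σ : ℂ) *
          ∏ i, ∑ x ∈ ({1, -1} : Finset ℂ), x * ((if σ i = i then x else 0) + A (σ i) i) := by
    simp_rw [Matrix.det_apply', Finset.mul_sum]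
    rw [Finset.sum_comm]
    refine Finset.sum_congr rfl fun σ _ => ?_
    rw [Finset.prod_univ_sum, Finset.mul_sum]
    refine Finset.sum_congr rfl fun e _ => ?_
    rw [Finset.prod_mul_distrib]
    have : ∀ i, (Matrix.diagonal e + A) (σ i) i = (if σ i = i then e i else 0) + A (σ i) i := by
      intro i
      rw [Matrix.add_apply, Matrix.diagonal_apply]
      split_ifs with h
      · rw [h]
      · rfl
    simp_rw [this]
    ring
  have h2 : ∀ (σ : Equiv.Perm (Fin m)) i, ∑ x ∈ ({1, -1} : Finset ℂ),
      x * ((if σ i = i then x else 0) + A (σ i) i) = if σ i = i then 2 else 0 := by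
    intro σ i
    rw [Finset.sum_pair (by norm_num)]
    split_ifs <;> ring
  simp_rw [h2] at h1
  rw [h0, Finset.sum_eq_single 1] at h1
  · simp only [Equiv.Perm.sign_one, Units.val_one, Int.cast_one, Equiv.Perm.one_apply, if_true,
      Finset.prod_const, one_mul] at h1
    exact pow_ne_zero _ two_ne_zero h1.symm
  · intro σ _ hσ
    obtain ⟨i, hi⟩ : ∃ i, σ i ≠ i := by
      by_contra! h
      exact hσ (Equiv.ext h)
    rw [Finset.prod_eq_zero (Finset.mem_univ i) (by simp [hi]), mul_zero]
  · simp

/-- A symmetric square root of the form matrix. -/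
def sqrtForm (n : ℕ) : Matrix (Fin (2 * n)) (Fin (2 * n)) ℂ :=
  ((1 - Complex.I) / 2) • (1 : Matrix (Fin (2 * n)) (Fin (2 * n)) ℂ)
    + ((1 + Complex.I) / 2) • formMatrix n

theorem sqrtForm_transpose (n : ℕ) : (sqrtForm n)ᵀ = sqrtForm n := by
  simp [sqrtForm, formMatrix_transpose]

/-- E is an involution; the chosen combination acts as 1 on its eigenspace for 1 and as -i on its
eigenspace for -1. -/
theorem sqrtForm_mul_self (n : ℕ) : sqrtForm n * sqrtForm n = formMatrix n := by
  have hE := formMatrix_mul_self n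
  have hI := Complex.I_mul_I
  simp only [sqrtForm, Matrix.add_mul, Matrix.mul_add, Matrix.smul_mul, Matrix.mul_smul, hE,
    Matrix.mul_one, Matrix.one_mul, smul_smul, smul_add]
  have h1 : (1 - Complex.I) / 2 * ((1 - Complex.I) / 2)
      + (1 + Complex.I) / 2 * ((1 + Complex.I) / 2) = 0 := by linear_combination hI / 2
  have h2 : (1 - Complex.I) / 2 * ((1 + Complex.I) / 2)
      + (1 + Complex.I) / 2 * ((1 - Complex.I) / 2) = 1 := by linear_combination -hI / 2
  calc _ = ((1 - Complex.I) / 2 * ((1 - Complex.I) / 2)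
      + (1 + Complex.I) / 2 * ((1 + Complex.I) / 2)) • (1 : Matrix (Fin (2 * n)) (Fin (2 * n)) ℂ)
      + ((1 - Complex.I) / 2 * ((1 + Complex.I) / 2)
      + (1 + Complex.I) / 2 * ((1 - Complex.I) / 2)) • formMatrix n := by module
    _ = formMatrix n := by rw [h1, h2, zero_smul, zero_add, one_smul]

theorem sqrtForm_mul_formMatrix (n : ℕ) :
    sqrtForm n * formMatrix n = formMatrix n * sqrtForm n := by
  rw [← sqrtForm_mul_self, Matrix.mul_assoc]

/-- Conjugation by the square root of the form, which carries complex orthogonal matrices to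
matrices preserving the form. -/
def conjForm {n : ℕ} (D : Matrix (Fin (2 * n)) (Fin (2 * n)) ℂ) :
    Matrix (Fin (2 * n)) (Fin (2 * n)) ℂ :=
  sqrtForm n * D * (formMatrix n * sqrtForm n)

theorem conjForm_mul {n : ℕ} (C D : Matrix (Fin (2 * n)) (Fin (2 * n)) ℂ) :
    conjForm (C * D) = conjForm C * conjForm D := by
  have h : (formMatrix n * sqrtForm n) * sqrtForm n = 1 := by
    rw [Matrix.mul_assoc, sqrtForm_mul_self, formMatrix_mul_self]
  calc conjForm (C * D) = sqrtForm n * C * ((formMatrix n * sqrtForm n) * sqrtForm n)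
        * D * (formMatrix n * sqrtForm n) := by
        rw [h, Matrix.mul_one]; simp only [conjForm, Matrix.mul_assoc]
    _ = conjForm C * conjForm D := by simp only [conjForm, Matrix.mul_assoc]

theorem conjForm_one {n : ℕ} : conjForm (n := n) 1 = 1 := by
  rw [conjForm, Matrix.mul_one, ← sqrtForm_mul_formMatrix, ← Matrix.mul_assoc, sqrtForm_mul_self,
    formMatrix_mul_self]

theorem conjForm_add {n : ℕ} (C D : Matrix (Fin (2 * n)) (Fin (2 * n)) ℂ) :
    conjForm (C + D) = conjForm C + conjForm D := by
  simp only [conjForm, Matrix.mul_add, Matrix.add_mul]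

theorem det_conjForm {n : ℕ} (D : Matrix (Fin (2 * n)) (Fin (2 * n)) ℂ) :
    (conjForm D).det = D.det := by
  have h := congrArg Matrix.det (conjForm_one (n := n))
  rw [conjForm, Matrix.det_mul, Matrix.det_mul, Matrix.det_one] at h
  rw [conjForm, Matrix.det_mul, Matrix.det_mul]
  linear_combination D.det * h

theorem conjForm_preserves {n : ℕ} {D : Matrix (Fin (2 * n)) (Fin (2 * n)) ℂ} (hD : Dᵀ * D = 1) :
    (conjForm D)ᵀ * formMatrix n * conjForm D = formMatrix n := by
  have h : sqrtForm n * formMatrix n * sqrtForm n = 1 := by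
    rw [sqrtForm_mul_formMatrix, Matrix.mul_assoc, sqrtForm_mul_self, formMatrix_mul_self]
  have h' : sqrtForm n * (formMatrix n * sqrtForm n) = 1 := by rw [← Matrix.mul_assoc, h]
  calc (conjForm D)ᵀ * formMatrix n * conjForm D
      = sqrtForm n * formMatrix n * (Dᵀ * (sqrtForm n * formMatrix n * sqrtForm n) * D)
        * (formMatrix n * sqrtForm n) := by
        simp only [conjForm, Matrix.transpose_mul, sqrtForm_transpose, formMatrix_transpose,
          Matrix.mul_assoc]
    _ = formMatrix n * (sqrtForm n * (formMatrix n * sqrtForm n)) := by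
        rw [h, Matrix.mul_one, hD, Matrix.mul_one, sqrtForm_mul_formMatrix, Matrix.mul_assoc]
    _ = formMatrix n := by rw [h', Matrix.mul_one]

theorem exists_conjForm_eq {n : ℕ} (M : Matrix (Fin (2 * n)) (Fin (2 * n)) ℂ) :
    ∃ D, conjForm D = M := by
  have h : sqrtForm n * (formMatrix n * sqrtForm n) = 1 := by
    simpa [conjForm] using conjForm_one (n := n)
  refine ⟨(formMatrix n * sqrtForm n) * M * sqrtForm n, ?_⟩
  calc conjForm ((formMatrix n * sqrtForm n) * M * sqrtForm n)
      = (sqrtForm n * (formMatrix n * sqrtForm n)) * M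
        * (sqrtForm n * (formMatrix n * sqrtForm n)) := by simp only [conjForm, Matrix.mul_assoc]
    _ = M := by rw [h, Matrix.one_mul, Matrix.mul_one]

/-- The diagonal sign matrix attached to a finite set of indices. -/
def signMatrix {m : ℕ} (s : Finset (Fin m)) : Matrix (Fin m) (Fin m) ℂ :=
  Matrix.diagonal fun i => if i ∈ s then (-1 : ℂ) else 1

theorem signMatrix_mul_self {m : ℕ} (s : Finset (Fin m)) : signMatrix s * signMatrix s = 1 := by
  rw [signMatrix, Matrix.diagonal_mul_diagonal, ← Matrix.diagonal_one]
  congr 1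
  funext i
  split_ifs <;> norm_num

theorem det_signMatrix {m : ℕ} (s : Finset (Fin m)) : (signMatrix s).det = (-1) ^ s.card := by
  rw [signMatrix, Matrix.det_diagonal, Finset.prod_ite]
  simp

/-- A quarter turn in a coordinate plane is the Cayley transform of an orthogonal matrix without
eigenvalue `-1`, and its square is a sign matrix. -/
theorem exists_orthogonal_mul_self_eq_signMatrix {m : ℕ} {i j : Fin m} (hij : i ≠ j) :
    ∃ R : Matrix (Fin m) (Fin m) ℂ, Rᵀ * R = 1 ∧ (1 + R).det ≠ 0 ∧ R * R = signMatrix {i, j} := by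
  set Y : Matrix (Fin m) (Fin m) ℂ := Matrix.single i j 1 - Matrix.single j i 1 with hY
  have hT : Yᵀ = -Y := by simp [hY]
  have hY2 : Y * Y = -(Matrix.single i i 1 + Matrix.single j j 1) := by
    simp only [hY, Matrix.sub_mul, Matrix.mul_sub, Matrix.single_mul_single_same,
      Matrix.single_mul_single_of_ne _ _ _ _ hij, Matrix.single_mul_single_of_ne _ _ _ _ hij.symm,
      mul_one]
    abel
  have hY3 : Y * Y * Y = -Y := by
    rw [hY2]
    simp only [hY, Matrix.neg_mul, Matrix.add_mul, Matrix.mul_sub, Matrix.single_mul_single_same,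
      Matrix.single_mul_single_of_ne _ _ _ _ hij, Matrix.single_mul_single_of_ne _ _ _ _ hij.symm,
      mul_one]
    abel
  -- Since Y³ = -Y, exp(θY) = 1 + sin θ · Y + (1 - cos θ) Y²; the witness is θ = -π/2.
  refine ⟨1 - Y + Y * Y, ?_, ?_, ?_⟩
  · rw [Matrix.transpose_add, Matrix.transpose_sub, Matrix.transpose_one, Matrix.transpose_mul, hT]
    calc (1 - -Y + -Y * -Y) * (1 - Y + Y * Y) = 1 + Y * Y + (Y * Y * Y) * Y := by noncomm_ring
      _ = 1 := by rw [hY3]; noncomm_ring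
  · intro h
    have h2 : (1 + (1 - Y + Y * Y)) * (1 + Y) = (2 : ℂ) • 1 := by
      calc (1 + (1 - Y + Y * Y)) * (1 + Y) = 1 + 1 + Y + Y * Y * Y := by noncomm_ring
        _ = (2 : ℂ) • 1 := by rw [hY3, two_smul]; abel
    have h3 := congrArg Matrix.det h2
    rw [Matrix.det_mul, h, zero_mul, Matrix.det_smul, Matrix.det_one, mul_one] at h3
    exact pow_ne_zero _ two_ne_zero h3.symm
  · have : (1 - Y + Y * Y) * (1 - Y + Y * Y) = 1 + 2 • (Y * Y) := by
      calc (1 - Y + Y * Y) * (1 - Y + Y * Y)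
          = 1 - 2 • Y + 3 • (Y * Y) - 2 • (Y * Y * Y) + (Y * Y * Y) * Y := by noncomm_ring
        _ = 1 + 2 • (Y * Y) := by rw [hY3]; noncomm_ring
    rw [this, hY2, signMatrix]
    ext a b
    simp only [Matrix.add_apply, Matrix.smul_apply, Matrix.neg_apply, Matrix.single_apply,
      Matrix.one_apply, Matrix.diagonal_apply, Finset.mem_insert, Finset.mem_singleton]
    by_cases hab : a = b
    · subst hab
      by_cases hai : a = i
      · subst hai
        norm_num [hij.symm]
      · by_cases haj : a = j
        · subst haj
          norm_num [hij]
        · simp [hai, haj, Ne.symm hai, Ne.symm haj]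
    · have h1 : ¬ (i = a ∧ i = b) := fun h => hab (h.1.symm.trans h.2)
      have h2 : ¬ (j = a ∧ j = b) := fun h => hab (h.1.symm.trans h.2)
      simp [hab, h1, h2]

/-- `SO_{2n}` is generated by its elements without eigenvalue `-1`. -/
theorem eq_top_of_forall_det_one_add_ne_zero {n : ℕ} (K : Submonoid (SO n))
    (hK : ∀ g : SO n, (1 + mat g).det ≠ 0 → g ∈ K) : K = ⊤ := by
  -- Sign matrices with an even number of -1 are products of squares of quarter turns, which have no
  -- eigenvalue -1.
  have hsign : ∀ (k : ℕ) (s : Finset (Fin (2 * n))), s.card = 2 * k →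
      ∃ g ∈ K, mat g = conjForm (signMatrix s) := by
    intro k
    induction k with
    | zero =>
      intro s hs
      refine ⟨1, K.one_mem, ?_⟩
      rw [Finset.card_eq_zero.mp hs, signMatrix]
      simp [conjForm_one]
    | succ k ih =>
      intro s hs
      obtain ⟨i, hi, j, hj, hij⟩ := Finset.one_lt_card.mp (show 1 < s.card by omega)
      have hsub : {i, j} ⊆ s := by
        intro a ha
        rcases Finset.mem_insert.mp ha with rfl | ha
        · exact hi
        · rwa [Finset.mem_singleton.mp ha]
      obtain ⟨g, hgK, hg⟩ := ih (s \ {i, j}) (by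
        rw [Finset.card_sdiff_of_subset hsub, Finset.card_pair hij]; omega)
      obtain ⟨R, hR1, hR2, hR3⟩ := exists_orthogonal_mul_self_eq_signMatrix hij
      have hdet : (1 + conjForm R).det ≠ 0 := by
        rw [← conjForm_one, ← conjForm_add, det_conjForm]; exact hR2
      set r : SO n := ofMatrix (conjForm R)
        (det_eq_one_of_det_one_add_ne_zero (conjForm_preserves hR1) hdet) (conjForm_preserves hR1)
      have hr : r ∈ K := hK r hdet
      refine ⟨g * (r * r), K.mul_mem hgK (K.mul_mem hr hr), ?_⟩
      rw [mat_mul, mat_mul, hg, mat_ofMatrix, ← conjForm_mul, ← conjForm_mul, hR3]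
      congr 1
      rw [signMatrix, signMatrix, signMatrix, Matrix.diagonal_mul_diagonal]
      congr 1
      funext a
      simp only [Finset.mem_sdiff]
      by_cases h : a ∈ ({i, j} : Finset (Fin (2 * n)))
      · simp [h, hsub h]
      · simp [h]
  rw [eq_top_iff]
  intro g _
  obtain ⟨A, hA⟩ := exists_conjForm_eq (mat g)
  obtain ⟨s, hs⟩ := exists_sign_det_diagonal_add_ne_zero A
  rw [← signMatrix] at hs
  have hS : (signMatrix s)ᵀ * signMatrix s = 1 := by
    rw [← signMatrix_mul_self s]
    simp [signMatrix]
  have hdS : (signMatrix s).det ≠ 0 := by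
    rw [det_signMatrix]; exact pow_ne_zero _ (by norm_num)
  -- Up to conjugation, 1 + S A = S (S + A), because S² = 1. So S g has no eigenvalue -1; it then
  -- has determinant 1, which forces S to have evenly many signs, and g = S (S g).
  have hdet : (1 + conjForm (signMatrix s) * mat g).det ≠ 0 := by
    rw [← hA, ← conjForm_mul, ← conjForm_one, ← conjForm_add, ← signMatrix_mul_self s,
      ← Matrix.mul_add, det_conjForm, Matrix.det_mul]
    exact mul_ne_zero hdS hs
  have hpres : (conjForm (signMatrix s) * mat g)ᵀ * formMatrix n * (conjForm (signMatrix s) * mat g)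
      = formMatrix n := by
    calc _ = (mat g)ᵀ * ((conjForm (signMatrix s))ᵀ * formMatrix n * conjForm (signMatrix s))
          * mat g := by simp only [Matrix.transpose_mul, Matrix.mul_assoc]
      _ = formMatrix n := by rw [conjForm_preserves hS, transpose_mul_formMatrix_mul]
  have hone := det_eq_one_of_det_one_add_ne_zero hpres hdet
  have heven : Even s.card := by
    rw [Matrix.det_mul, det_mat, mul_one, det_conjForm, det_signMatrix] at hone
    rcases Nat.even_or_odd s.card with h | h
    · exact h
    · rw [h.neg_one_pow] at hone
      norm_num at hone
  obtain ⟨k, hk⟩ := heven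
  obtain ⟨r, hrK, hr⟩ := hsign k s (by omega)
  have hrg : r * g ∈ K := hK _ (by rw [mat_mul, hr]; exact hdet)
  have hrr : r * (r * g) = g := mat_injective (by
    rw [mat_mul, mat_mul, hr, ← Matrix.mul_assoc, ← conjForm_mul, signMatrix_mul_self, conjForm_one,
      Matrix.one_mul])
  exact hrr ▸ K.mul_mem hrK hrg

/-! ### Cayley paths and holomorphic dependence -/

section Analytic

open Filter Topology

theorem differentiableAt_det {m : ℕ} {M : ℂ → Matrix (Fin m) (Fin m) ℂ} {a : ℂ}
    (hM : ∀ i j, DifferentiableAt ℂ (fun z => M z i j) a) :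
    DifferentiableAt ℂ (fun z => (M z).det) a := by
  simp only [Matrix.det_apply']
  fun_prop

theorem differentiableAt_inv_apply {m : ℕ} {M : ℂ → Matrix (Fin m) (Fin m) ℂ} {a : ℂ}
    (hM : ∀ i j, DifferentiableAt ℂ (fun z => M z i j) a) (ha : (M a).det ≠ 0) (i j : Fin m) :
    DifferentiableAt ℂ (fun z => (M z)⁻¹ i j) a := by
  simp only [Matrix.inv_def, Ring.inverse_eq_inv', Matrix.smul_apply, smul_eq_mul,
    Matrix.adjugate_apply]
  refine ((differentiableAt_det hM).inv ha).mul (differentiableAt_det fun k l => ?_)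
  simp only [Matrix.updateRow_apply]
  split_ifs
  · exact differentiableAt_const _
  · exact hM k l

theorem differentiableAt_mul_apply {m : ℕ} {M N : ℂ → Matrix (Fin m) (Fin m) ℂ} {a : ℂ}
    (hM : ∀ i j, DifferentiableAt ℂ (fun z => M z i j) a)
    (hN : ∀ i j, DifferentiableAt ℂ (fun z => N z i j) a) (i j : Fin m) :
    DifferentiableAt ℂ (fun z => (M z * N z) i j) a := by
  simp only [Matrix.mul_apply]
  fun_prop

theorem differentiableAt_eval {ι : Type*} (P : MvPolynomial ι ℂ) {f : ℂ → ι → ℂ} {a : ℂ}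
    (hf : ∀ i, DifferentiableAt ℂ (fun z => f z i) a) :
    DifferentiableAt ℂ (fun z => MvPolynomial.eval (f z) P) a := by
  induction P using MvPolynomial.induction_on with
  | C c => simp
  | add p q hp hq =>
    simp only [map_add]
    exact hp.add hq
  | mul_X p i hp =>
    simp only [map_mul, MvPolynomial.eval_X]
    exact hp.mul (hf i)

/-- The parameters at which a pencil of matrices is invertible form a connected set. -/
theorem isPreconnected_setOf_det_ne_zero {m : ℕ} (A B : Matrix (Fin m) (Fin m) ℂ)
    (hA : A.det ≠ 0) : IsPreconnected {z : ℂ | (A + z • B).det ≠ 0} := by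
  set p : Polynomial ℂ := ((Polynomial.X : Polynomial ℂ) • B.map Polynomial.C
    + A.map Polynomial.C).det with hp
  have heval : ∀ z, p.eval z = (A + z • B).det := by
    intro z
    rw [hp, ← Polynomial.coe_evalRingHom, RingHom.map_det]
    congr 1
    ext i j
    simp only [Polynomial.coe_evalRingHom, RingHom.mapMatrix_apply, Matrix.map_apply,
      Matrix.add_apply, Matrix.smul_apply, smul_eq_mul, Polynomial.eval_add, Polynomial.eval_mul,
      Polynomial.eval_X, Polynomial.eval_C]
    ring
  have hp0 : p ≠ 0 := by
    intro h
    have := heval 0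
    rw [h] at this
    simp at this
    exact hA this.symm
  have hset : {z : ℂ | (A + z • B).det ≠ 0} = {z | p.IsRoot z}ᶜ := by
    ext z
    simp [Polynomial.IsRoot, heval]
  rw [hset]
  -- Removing finitely many points from ℂ, of real dimension 2, leaves a connected set.
  have hfin : {z | p.IsRoot z}.Finite := Polynomial.finite_setOfPred_isRoot hp0
  exact (hfin.countable.isConnected_compl_of_one_lt_rank
    (by rw [Complex.rank_real_complex]; exact Nat.one_lt_ofNat)).isPreconnected

/-- The Cayley path from the identity to an element of `SO_{2n}` without eigenvalue `-1`. -/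
theorem exists_mat_eq_cayley {n : ℕ} (g : SO n) (hg : (1 + mat g).det ≠ 0) (z : ℂ)
    (hz : ((1 + mat g) + z • (1 - mat g)).det ≠ 0) :
    ∃ h : SO n, mat h = ((1 + mat g) - z • (1 - mat g)) * ((1 + mat g) + z • (1 - mat g))⁻¹ := by
  set D := (1 + mat g) + z • (1 - mat g) with hD
  set N := (1 + mat g) - z • (1 - mat g) with hN
  have hDi : D * D⁻¹ = 1 := Matrix.mul_nonsing_inv _ hz.isUnit
  have hgg := transpose_mul_formMatrix_mul g
  -- N(z) = D(-z), and the terms of Dᵀ E D that are linear in z cancel because g preserves the form.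
  have hDN : Dᵀ * formMatrix n * D = Nᵀ * formMatrix n * N := by
    simp only [hD, hN, Matrix.transpose_add, Matrix.transpose_sub, Matrix.transpose_smul,
      Matrix.transpose_one, Matrix.add_mul, Matrix.mul_add, Matrix.sub_mul, Matrix.mul_sub,
      Matrix.smul_mul, Matrix.mul_smul, Matrix.mul_one, Matrix.one_mul, hgg]
    module
  have hpres : (N * D⁻¹)ᵀ * formMatrix n * (N * D⁻¹) = formMatrix n := by
    have hDt : (D⁻¹)ᵀ * Dᵀ = 1 := by rw [← Matrix.transpose_mul, hDi, Matrix.transpose_one]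
    calc (N * D⁻¹)ᵀ * formMatrix n * (N * D⁻¹)
        = (D⁻¹)ᵀ * (Nᵀ * formMatrix n * N) * D⁻¹ := by
          simp only [Matrix.transpose_mul, Matrix.mul_assoc]
      _ = ((D⁻¹)ᵀ * Dᵀ) * formMatrix n * (D * D⁻¹) := by
          rw [← hDN]; simp only [Matrix.mul_assoc]
      _ = formMatrix n := by rw [hDt, hDi, Matrix.one_mul, Matrix.mul_one]
  have hdet : (1 + N * D⁻¹).det ≠ 0 := by
    intro h
    -- The Cayley transform again has no eigenvalue -1, since N + D = 2(1 + g); its determinant is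
    -- therefore 1.
    have h1 : (1 + N * D⁻¹) * D = (2 : ℂ) • (1 + mat g) := by
      rw [Matrix.add_mul, Matrix.mul_assoc, Matrix.nonsing_inv_mul _ hz.isUnit, Matrix.one_mul,
        Matrix.mul_one, hD, hN]
      module
    have h2 := congrArg Matrix.det h1
    rw [Matrix.det_mul, h, zero_mul, Matrix.det_smul] at h2
    exact mul_ne_zero (pow_ne_zero _ two_ne_zero) hg h2.symm
  exact ⟨ofMatrix _ (det_eq_one_of_det_one_add_ne_zero hpres hdet) hpres, rfl⟩

end Analytic

/-! ### Highest weight vectors and the contracting torus element -/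

section HighestWeightVector

open Filter Topology

variable {n : ℕ} {V : Type u} [AddCommGroup V] [Module ℂ V] {ρ : Representation ℂ (SO n) V}
  {d : Fin n → ℤ} {x : V}

theorem mem_of_forall_dual {V : Type*} [AddCommGroup V] [Module ℂ V] {S : Submodule ℂ V} {v : V}
    (h : ∀ φ : Module.Dual ℂ V, (∀ w ∈ S, φ w = 0) → φ v = 0) : v ∈ S := by
  by_contra hv
  obtain ⟨φ, hφ, hφS⟩ := S.exists_dual_map_eq_bot_of_notMem hv inferInstance
  exact hφ (h φ fun w hw => by
    have : φ w ∈ S.map φ := Submodule.mem_map_of_mem hw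
    rwa [hφS, Submodule.mem_bot] at this)

/-- A highest weight vector generates the same subspace under the lower unipotent elements as under
the whole group. -/
theorem orbit_mem_span_lowerUnipotent (hρ : IsRational ρ)
    (hx : ∀ b : SO n, IsBorel b → ρ b x = borelCharacter d b • x) (g : SO n) :
    ρ g x ∈ Submodule.span ℂ {v | ∃ l : SO n, IsLowerUnipotent l ∧ v = ρ l x} := by
  set S := Submodule.span ℂ {v | ∃ l : SO n, IsLowerUnipotent l ∧ v = ρ l x} with hS
  -- The stabiliser of the span is a submonoid, so only elements without eigenvalue -1 need be
  -- treated.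
  let K : Submonoid (SO n) :=
    { carrier := {g | ∀ v ∈ S, ρ g v ∈ S}
      mul_mem' := fun {a b} ha hb v hv => by
        rw [map_mul, Module.End.mul_apply]
        exact ha _ (hb _ hv)
      one_mem' := fun v hv => by rwa [map_one, Module.End.one_apply] }
  have hK : K = ⊤ := by
    refine eq_top_of_forall_det_one_add_ne_zero K fun g hg v hv => ?_
    suffices h : S ≤ S.comap (ρ g) from h hv
    nth_rewrite 1 [hS]
    rw [Submodule.span_le]
    rintro _ ⟨l, hl, rfl⟩
    change ρ g (ρ l x) ∈ S
    refine mem_of_forall_dual fun φ hφ => ?_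
    obtain ⟨P, hP⟩ := hρ φ x
    set D : ℂ → Matrix (Fin (2 * n)) (Fin (2 * n)) ℂ :=
      fun z => (1 + mat g) + z • (1 - mat g) with hD
    set N : ℂ → Matrix (Fin (2 * n)) (Fin (2 * n)) ℂ :=
      fun z => (1 + mat g) - z • (1 - mat g) with hN
    -- A path with values in the group, from l at z = 0 to g l at z = 1. The function `F` is z ↦
    -- φ(ρ(H z) x), for φ vanishing on the span.
    set H : ℂ → Matrix (Fin (2 * n)) (Fin (2 * n)) ℂ := fun z => N z * (D z)⁻¹ * mat l with hH
    set U : Set ℂ := {z | (D z).det ≠ 0} with hU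
    set F : ℂ → ℂ := fun z => MvPolynomial.eval (fun ij => H z ij.1 ij.2) P with hF
    have hDd : ∀ a i j, DifferentiableAt ℂ (fun z => D z i j) a := fun a i j => by
      simp only [hD, Matrix.add_apply, Matrix.smul_apply, smul_eq_mul]
      fun_prop
    have hNd : ∀ a i j, DifferentiableAt ℂ (fun z => N z i j) a := fun a i j => by
      simp only [hN, Matrix.sub_apply, Matrix.smul_apply, smul_eq_mul]
      fun_prop
    have hHd : ∀ a ∈ U, ∀ i j, DifferentiableAt ℂ (fun z => H z i j) a := fun a ha i j =>
      differentiableAt_mul_apply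
        (differentiableAt_mul_apply (hNd a) (differentiableAt_inv_apply (hDd a) ha))
        (N := fun _ => mat l) (fun _ _ => differentiableAt_const _) i j
    have hUo : IsOpen U := by
      have : Continuous fun z => (D z).det :=
        continuous_iff_continuousAt.mpr fun a => (differentiableAt_det (hDd a)).continuousAt
      exact isOpen_ne.preimage this
    have hUc : IsPreconnected U := isPreconnected_setOf_det_ne_zero _ _ hg
    have h0 : (0 : ℂ) ∈ U := by simpa [hU, hD] using hg
    have hH0 : H 0 = mat l := by
      have h1 : N 0 = D 0 := by simp [hN, hD]
      rw [hH]
      simp only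
      rw [h1, Matrix.mul_nonsing_inv _ (Ne.isUnit h0), Matrix.one_mul]
    have hrep : ∀ z ∈ U, ∃ h : SO n, mat h = H z := by
      intro z hz
      obtain ⟨h, hh⟩ := exists_mat_eq_cayley g hg z hz
      exact ⟨h * l, by rw [mat_mul, hh]⟩
    have hFan : AnalyticOnNhd ℂ F U := by
      refine DifferentiableOn.analyticOnNhd (fun a ha => ?_) hUo
      exact (differentiableAt_eval P fun ij => hHd a ha ij.1 ij.2).differentiableWithinAt
    -- The leading minors of l are 1, hence those of H(z) stay nonzero near 0. There H(z) = l' b, so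
    -- ρ(H z) x is a multiple of ρ(l') x and φ kills it.
    have hF0 : F =ᶠ[𝓝 0] 0 := by
      have hminor : ∀ᶠ z in 𝓝 (0 : ℂ), ∀ k : Fin (2 * n + 1),
          ((H z).submatrix (Fin.castLE (Nat.lt_succ_iff.mp k.2))
            (Fin.castLE (Nat.lt_succ_iff.mp k.2))).det ≠ 0 := by
        refine Filter.eventually_all.mpr fun k => ?_
        have hc : ContinuousAt (fun z => ((H z).submatrix (Fin.castLE (Nat.lt_succ_iff.mp k.2))
            (Fin.castLE (Nat.lt_succ_iff.mp k.2))).det) 0 :=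
          (differentiableAt_det fun i j => hHd 0 h0 _ _).continuousAt
        refine hc.eventually_ne ?_
        have hlow : ((mat l).submatrix (Fin.castLE (Nat.lt_succ_iff.mp k.2))
            (Fin.castLE (Nat.lt_succ_iff.mp k.2))).IsLowerTriangular := fun i j h =>
          hl.2 (Fin.castLE _ i) (Fin.castLE _ j) h
        rw [hH0, Matrix.det_of_isLowerTriangular _ hlow]
        simp [hl.1]
      filter_upwards [hminor, hUo.mem_nhds h0] with z hz hzU
      obtain ⟨h, hh⟩ := hrep z hzU
      obtain ⟨l', b, hl', hb, rfl⟩ := exists_eq_lowerUnipotent_mul_borel h fun k hk => by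
        rw [hh]
        exact hz ⟨k, Nat.lt_succ_of_le hk⟩
      rw [hF]
      simp only [Pi.zero_apply]
      rw [← hh, ← hP, map_mul, Module.End.mul_apply, hx b hb, map_smul, map_smul,
        hφ _ (Submodule.subset_span ⟨l', hl', rfl⟩), smul_zero]
    have h1 : (1 : ℂ) ∈ U := by
      have : D 1 = (2 : ℂ) • 1 := by simp only [hD]; module
      rw [hU, Set.mem_ofPred_eq, this, Matrix.det_smul, Matrix.det_one, mul_one]
      exact pow_ne_zero _ two_ne_zero
    have hF1 := hFan.eqOn_zero_of_preconnected_of_eventuallyEq_zero hUc h0 hF0 h1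
    have hH1 : H 1 = mat (g * l) := by
      have e1 : N 1 = mat g * D 1 := by
        simp only [hN, hD, Matrix.mul_add, Matrix.mul_smul, Matrix.mul_sub, Matrix.mul_one]
        module
      rw [mat_mul, hH]
      simp only
      rw [e1, Matrix.mul_assoc (mat g), Matrix.mul_nonsing_inv _ (Ne.isUnit h1), Matrix.mul_one]
    rw [hF] at hF1
    simp only [Pi.zero_apply] at hF1
    rw [hH1, ← hP, map_mul, Module.End.mul_apply] at hF1
    exact hF1
  have hgK : g ∈ K := hK ▸ Submonoid.mem_top g
  exact hgK x (Submodule.subset_span ⟨1, ⟨fun i => by simp, fun i j h => by simp [h.ne]⟩,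
    by simp⟩)

/-- A regular dominant element of the torus. -/
def dominantElt (n : ℕ) : SO n :=
  torusElt fun i => (Units.mk0 (2 : ℂ) two_ne_zero) ^ (n - i.1)

theorem mat_torusElt {n : ℕ} (t : Fin n → ℂˣ) :
    mat (torusElt t) = Matrix.diagonal fun i => (torusEntry t i : ℂ) := rfl

theorem isBorel_torusElt {n : ℕ} (t : Fin n → ℂˣ) : IsBorel (torusElt t) := fun i j h => by
  rw [mat_torusElt, Matrix.diagonal_apply_ne _ h.ne']

theorem torusEntry_firstHalf {n : ℕ} (t : Fin n → ℂˣ) (i : Fin n) :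
    torusEntry t (firstHalf i) = t i := by
  simp [torusEntry, firstHalf]

theorem borelCharacter_torusElt {n : ℕ} (d : Fin n → ℤ) (t : Fin n → ℂˣ) :
    borelCharacter d (torusElt t) = ∏ i, (t i : ℂ) ^ d i := by
  simp [borelCharacter, mat_torusElt, torusEntry_firstHalf]

/-- The entries are 2^n, …, 2, 1/2, …, 2^{-n}. Their strict decrease is the regularity that makes
conjugation contract the lower triangle. -/
theorem norm_torusEntry_lt {n : ℕ} {i j : Fin (2 * n)} (hij : j < i) :
    ‖(torusEntry (fun i : Fin n => (Units.mk0 (2 : ℂ) two_ne_zero) ^ (n - i.1)) i : ℂ)‖ <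
    ‖(torusEntry (fun i : Fin n => (Units.mk0 (2 : ℂ) two_ne_zero) ^ (n - i.1)) j : ℂ)‖ := by
  have hij' : j.1 < i.1 := hij
  have hi := i.2
  unfold torusEntry
  by_cases h1 : i.1 < n
  · have h2 : j.1 < n := by omega
    rw [dif_pos h1, dif_pos h2]
    simp only [Units.val_pow_eq_pow_val, Units.val_mk0, norm_pow, Complex.norm_ofNat]
    exact pow_lt_pow_right₀ one_lt_two (by omega)
  · by_cases h2 : j.1 < n
    · rw [dif_neg h1, dif_pos h2]
      simp only [Units.val_pow_eq_pow_val, Units.val_mk0, norm_pow, Complex.norm_ofNat,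
        Units.val_inv_eq_inv_val, norm_inv, Fin.val_rev]
      refine lt_of_lt_of_le (inv_lt_one_of_one_lt₀ (one_lt_pow₀ one_lt_two (by omega)))
        (one_le_pow₀ one_le_two)
    · rw [dif_neg h1, dif_neg h2]
      simp only [Units.val_pow_eq_pow_val, Units.val_mk0, norm_pow, Complex.norm_ofNat,
        Units.val_inv_eq_inv_val, norm_inv, Fin.val_rev]
      exact inv_strictAnti₀ (by positivity) (pow_lt_pow_right₀ one_lt_two (by omega))

theorem mat_torusElt_pow {n : ℕ} (t : Fin n → ℂˣ) (k : ℕ) :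
    mat (torusElt t ^ k) = Matrix.diagonal fun i => (torusEntry t i : ℂ) ^ k := by
  induction k with
  | zero => simp
  | succ k ih => rw [pow_succ, mat_mul, ih, mat_torusElt, Matrix.diagonal_mul_diagonal]; rfl

theorem mat_torusElt_pow_inv {n : ℕ} (t : Fin n → ℂˣ) (k : ℕ) :
    mat (torusElt t ^ k)⁻¹ = Matrix.diagonal fun i => ((torusEntry t i : ℂ) ^ k)⁻¹ := by
  have h1 : mat (torusElt t ^ k) * mat (torusElt t ^ k)⁻¹ = 1 := by
    rw [← mat_mul, mul_inv_cancel, mat_one]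
  have h2 : (Matrix.diagonal fun i => ((torusEntry t i : ℂ) ^ k)⁻¹) * mat (torusElt t ^ k) = 1 := by
    rw [mat_torusElt_pow, Matrix.diagonal_mul_diagonal, ← Matrix.diagonal_one]
    congr 1
    funext i
    exact inv_mul_cancel₀ (pow_ne_zero _ (Units.ne_zero _))
  exact (left_inv_eq_right_inv h2 h1).symm

/-- Conjugation multiplies the (i, j) entry by (τ_i / τ_j)^k, which tends to 0 below the diagonal,
and matrix coefficients are polynomials, hence continuous. -/
theorem tendsto_conj_lowerUnipotent (hρ : IsRational ρ) {l : SO n} (hl : IsLowerUnipotent l)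
    (φ : Module.Dual ℂ V) (x : V) :
    Tendsto (fun k : ℕ => φ (ρ (dominantElt n ^ k * l * (dominantElt n ^ k)⁻¹) x)) atTop
      (𝓝 (φ x)) := by
  obtain ⟨P, hP⟩ := hρ φ x
  have h1 : φ x = MvPolynomial.eval (fun ij => mat (1 : SO n) ij.1 ij.2) P := by
    rw [← hP, map_one, Module.End.one_apply]
  simp only [hP]
  rw [h1]
  refine ((MvPolynomial.continuous_eval P).tendsto _).comp (tendsto_pi_nhds.mpr fun ij => ?_)
  obtain ⟨i, j⟩ := ij
  set τ : Fin (2 * n) → ℂ := fun i => (torusEntry (fun i : Fin n =>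
    (Units.mk0 (2 : ℂ) two_ne_zero) ^ (n - i.1)) i : ℂ) with hτ
  have hτ0 : ∀ i, τ i ≠ 0 := fun i => Units.ne_zero _
  have hent : ∀ k, mat (dominantElt n ^ k * l * (dominantElt n ^ k)⁻¹) i j
      = (τ i / τ j) ^ k * mat l i j := by
    intro k
    rw [mat_mul, mat_mul, dominantElt, mat_torusElt_pow, mat_torusElt_pow_inv,
      Matrix.mul_diagonal, Matrix.diagonal_mul, div_pow]
    ring
  simp only [hent]
  rcases lt_trichotomy i j with h | rfl | h
  · simp [hl.2 i j h, h.ne]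
  · simp [hl.1, hτ0 i]
  · rw [mat_one, Matrix.one_apply_ne h.ne']
    have hlt : ‖τ i / τ j‖ < 1 := by
      rw [norm_div, div_lt_one (norm_pos_iff.mpr (hτ0 j))]
      exact norm_torusEntry_lt h
    simpa using (tendsto_pow_atTop_nhds_zero_of_norm_lt_one hlt).mul_const (mat l i j)

theorem borelCharacter_dominantElt_ne_zero (d : Fin n → ℤ) :
    borelCharacter d (dominantElt n) ≠ 0 := by
  rw [dominantElt, borelCharacter_torusElt]
  exact Finset.prod_ne_zero_iff.mpr fun i _ => zpow_ne_zero _ (Units.ne_zero _)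

theorem dominantElt_pow_apply (hx : ∀ b : SO n, IsBorel b → ρ b x = borelCharacter d b • x)
    (k : ℕ) : ρ (dominantElt n ^ k) x = borelCharacter d (dominantElt n) ^ k • x := by
  induction k with
  | zero => simp
  | succ k ih =>
    rw [pow_succ, map_mul, Module.End.mul_apply, hx (dominantElt n) (isBorel_torusElt _), map_smul,
      ih, smul_smul, pow_succ, mul_comm]

/-- In the representation generated by a highest weight vector `x`, the rescaled powers of a regular
dominant torus element converge to a projection onto the line of `x`. -/
theorem exists_tendsto_of_mem_span_orbit (hρ : IsRational ρ)
    (hx : ∀ b : SO n, IsBorel b → ρ b x = borelCharacter d b • x) {v : V}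
    (hv : v ∈ Submodule.span ℂ (Set.range fun g => ρ g x)) :
    ∃ c : ℂ, ∀ φ : Module.Dual ℂ V,
      Tendsto (fun k : ℕ => (borelCharacter d (dominantElt n) ^ k)⁻¹ * φ (ρ (dominantElt n ^ k) v))
        atTop (𝓝 (c * φ x)) := by
  have hle : Submodule.span ℂ (Set.range fun g => ρ g x) ≤
      Submodule.span ℂ {v | ∃ l : SO n, IsLowerUnipotent l ∧ v = ρ l x} := by
    rw [Submodule.span_le]
    rintro _ ⟨g, rfl⟩
    exact orbit_mem_span_lowerUnipotent hρ hx g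
  set m := borelCharacter d (dominantElt n) with hm
  have hm0 : m ≠ 0 := borelCharacter_dominantElt_ne_zero d
  have hpow := dominantElt_pow_apply hx
  have hv' := hle hv
  clear hv
  induction hv' using Submodule.span_induction with
  | mem v hv =>
    obtain ⟨l, hl, rfl⟩ := hv
    refine ⟨1, fun φ => ?_⟩
    rw [one_mul]
    refine (tendsto_conj_lowerUnipotent hρ hl φ x).congr fun k => ?_
    -- a^k l x = (a^k l a^{-k}) a^k x, and a^k x = m^k x; so after rescaling, each generator ρ(l) x
    -- has limit x, with coefficient 1.
    have h1 : ρ (dominantElt n ^ k * l * (dominantElt n ^ k)⁻¹) (m ^ k • x)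
        = ρ (dominantElt n ^ k) (ρ l x) := by
      rw [← hpow, ← Module.End.mul_apply, ← map_mul, ← Module.End.mul_apply, ← map_mul,
        inv_mul_cancel_right]
    rw [← h1, map_smul, map_smul, smul_eq_mul, ← mul_assoc,
      inv_mul_cancel₀ (pow_ne_zero _ hm0), one_mul]
  | zero => exact ⟨0, fun φ => by simp⟩
  | add v w _ _ hv hw =>
    obtain ⟨a, ha⟩ := hv
    obtain ⟨b, hb⟩ := hw
    refine ⟨a + b, fun φ => ?_⟩
    rw [add_mul]
    refine ((ha φ).add (hb φ)).congr fun k => ?_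
    rw [map_add, map_add, mul_add]
  | smul r v _ hv =>
    obtain ⟨a, ha⟩ := hv
    refine ⟨r * a, fun φ => ?_⟩
    rw [mul_assoc]
    refine ((ha φ).const_mul r).congr fun k => ?_
    rw [map_smul, map_smul, smul_eq_mul]
    ring

end HighestWeightVector

/-! ### Uniqueness of the representation with a given highest weight -/

section Uniqueness

open Filter Topology

variable {n : ℕ} {V : Type u} [AddCommGroup V] [Module ℂ V] {W : Type v} [AddCommGroup W]
  [Module ℂ W] {ρ : Representation ℂ (SO n) V} {σ : Representation ℂ (SO n) W}

theorem IsRational.prod (hρ : IsRational ρ) (hσ : IsRational σ) : IsRational (ρ.prod σ) := by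
  intro φ x
  obtain ⟨P, hP⟩ := hρ (φ ∘ₗ LinearMap.inl ℂ V W) x.1
  obtain ⟨Q, hQ⟩ := hσ (φ ∘ₗ LinearMap.inr ℂ V W) x.2
  refine ⟨P + Q, fun g => ?_⟩
  rw [map_add, ← hP, ← hQ, LinearMap.comp_apply, LinearMap.comp_apply, ← map_add]
  congr 1
  simp [Representation.prod]

theorem span_orbit_stable {x v : V} (g : SO n)
    (hv : v ∈ Submodule.span ℂ (Set.range fun g => ρ g x)) :
    ρ g v ∈ Submodule.span ℂ (Set.range fun g => ρ g x) := by
  suffices h : Submodule.span ℂ (Set.range fun g => ρ g x) ≤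
      (Submodule.span ℂ (Set.range fun g => ρ g x)).comap (ρ g) from h hv
  rw [Submodule.span_le]
  rintro _ ⟨h, rfl⟩
  exact Submodule.subset_span ⟨g * h, by simp⟩

theorem eq_bot_or_eq_top_of_stable (hρ : ρ.IsIrreducible) (S : Submodule ℂ V)
    (hS : ∀ g, ∀ v ∈ S, ρ g v ∈ S) : S = ⊥ ∨ S = ⊤ :=
  (hρ.eq_bot_or_eq_top ⟨S, fun g v hv => hS g v hv⟩).imp (congrArg Subrepresentation.toSubmodule)
    (congrArg Subrepresentation.toSubmodule)

theorem span_orbit_eq_top (hρ : ρ.IsIrreducible) {x : V} (hx : x ≠ 0) :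
    Submodule.span ℂ (Set.range fun g => ρ g x) = ⊤ := by
  refine (eq_bot_or_eq_top_of_stable hρ _ fun g v hv => span_orbit_stable g hv).resolve_left ?_
  intro h
  have : x ∈ Submodule.span ℂ (Set.range fun g => ρ g x) := Submodule.subset_span ⟨1, by simp⟩
  rw [h, Submodule.mem_bot] at this
  exact hx this

/-- The span of the orbit of a pair of highest weight vectors of the same weight. -/
def pairSpan (ρ : Representation ℂ (SO n) V) (σ : Representation ℂ (SO n) W) (x : V) (y : W) :
    Submodule ℂ (V × W) :=
  Submodule.span ℂ (Set.range fun g => (ρ g x, σ g y))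

theorem pairSpan_stable {x : V} {y : W} (g : SO n) {v : V} {w : W}
    (h : (v, w) ∈ pairSpan ρ σ x y) : (ρ g v, σ g w) ∈ pairSpan ρ σ x y :=
  span_orbit_stable (ρ := ρ.prod σ) (x := (x, y)) g h

theorem pairSpan_swap {x : V} {y : W} {v : V} {w : W} (h : (v, w) ∈ pairSpan ρ σ x y) :
    (w, v) ∈ pairSpan σ ρ y x := by
  suffices h' : pairSpan ρ σ x y ≤
      (pairSpan σ ρ y x).comap (LinearEquiv.prodComm ℂ V W).toLinearMap from h' h
  rw [pairSpan, Submodule.span_le]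
  rintro _ ⟨g, rfl⟩
  exact Submodule.subset_span ⟨g, rfl⟩

/-- The fibre over 0 is a stable subspace of the irreducible W. If it were all of W, (0, y) would
lie in the span of the orbit of (x, y); its rescaled iterates are constantly (0, y) yet converge to
c (x, y), forcing both c = 0 and c = 1. -/
theorem eq_zero_of_mem_pairSpan {d : Fin n → ℤ} (hρ : IsRational ρ) (hσ : IsRational σ)
    (hσi : σ.IsIrreducible) {x : V} {y : W} (hx0 : x ≠ 0) (hy0 : y ≠ 0)
    (hx : ∀ b : SO n, IsBorel b → ρ b x = borelCharacter d b • x)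
    (hy : ∀ b : SO n, IsBorel b → σ b y = borelCharacter d b • y) {w : W}
    (hw : ((0 : V), w) ∈ pairSpan ρ σ x y) : w = 0 := by
  rcases eq_bot_or_eq_top_of_stable hσi ((pairSpan ρ σ x y).comap (LinearMap.inr ℂ V W))
    (fun g w hw => by simpa using pairSpan_stable g hw) with h | h
  · have : w ∈ (pairSpan ρ σ x y).comap (LinearMap.inr ℂ V W) := hw
    rwa [h, Submodule.mem_bot] at this
  · exfalso
    have hy' : y ∈ (pairSpan ρ σ x y).comap (LinearMap.inr ℂ V W) := h ▸ Submodule.mem_top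
    have hxy : ∀ b : SO n, IsBorel b →
        (ρ.prod σ) b (x, y) = borelCharacter d b • (x, y) := fun b hb =>
      Prod.ext (hx b hb) (hy b hb)
    obtain ⟨c, hc⟩ := exists_tendsto_of_mem_span_orbit (hρ.prod hσ) hxy (v := ((0 : V), y)) hy'
    obtain ⟨φ, hφ⟩ := Module.Projective.exists_dual_eq_one ℂ hx0
    obtain ⟨ψ, hψ⟩ := Module.Projective.exists_dual_eq_one ℂ hy0
    have h1 := hc (φ ∘ₗ LinearMap.fst ℂ V W)
    have h2 := hc (ψ ∘ₗ LinearMap.snd ℂ V W)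
    have e1 : ∀ k : ℕ, (φ ∘ₗ LinearMap.fst ℂ V W) ((ρ.prod σ) (dominantElt n ^ k) (0, y)) = 0 :=
      fun k => by simp [Representation.prod]
    have e2 : ∀ k : ℕ, (borelCharacter d (dominantElt n) ^ k)⁻¹ *
        (ψ ∘ₗ LinearMap.snd ℂ V W) ((ρ.prod σ) (dominantElt n ^ k) (0, y)) = 1 := by
      intro k
      have : (ψ ∘ₗ LinearMap.snd ℂ V W) ((ρ.prod σ) (dominantElt n ^ k) (0, y))
        = ψ (σ (dominantElt n ^ k) y) := rfl
      rw [this, dominantElt_pow_apply hy, map_smul, hψ, smul_eq_mul, mul_one,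
        inv_mul_cancel₀ (pow_ne_zero _ (borelCharacter_dominantElt_ne_zero d))]
    simp only [e1, mul_zero] at h1
    simp only [e2] at h2
    have c0 := tendsto_nhds_unique h1 tendsto_const_nhds
    have c1 := tendsto_nhds_unique h2 tendsto_const_nhds
    simp only [LinearMap.comp_apply, LinearMap.fst_apply, LinearMap.snd_apply, hφ, hψ,
      mul_one] at c0 c1
    rw [c0] at c1
    exact zero_ne_one c1

/-- Irreducible rational representations with the same highest weight are isomorphic. -/
theorem exists_equiv_of_highestWeight {μ : Fin n → ℚ} (hρ : IsIrrepOfHighestWeight ρ μ)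
    (hσ : IsIrrepOfHighestWeight σ μ) :
    ∃ e : V ≃ₗ[ℂ] W, ∀ g v, e (ρ g v) = σ g (e v) := by
  obtain ⟨d, hd, x, hx0, hx⟩ := hρ.highest
  obtain ⟨d', hd', y, hy0, hy⟩ := hσ.highest
  obtain rfl : d = d' := funext fun i => by
    have := (hd i).trans (hd' i).symm
    exact_mod_cast this
  -- The span of the orbit of (x, y) is the graph of the isomorphism: both projections are bijective
  -- on it.
  set N := pairSpan ρ σ x y with hN
  set p : N →ₗ[ℂ] V := LinearMap.fst ℂ V W ∘ₗ N.subtype with hp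
  set q : N →ₗ[ℂ] W := LinearMap.snd ℂ V W ∘ₗ N.subtype with hq
  have hpi : Function.Injective p := by
    rw [← LinearMap.ker_eq_bot, LinearMap.ker_eq_bot']
    rintro ⟨⟨v, w⟩, hvw⟩ h
    obtain rfl : v = 0 := h
    obtain rfl := eq_zero_of_mem_pairSpan hρ.rational hσ.rational hσ.irreducible hx0 hy0 hx hy hvw
    rfl
  have hqi : Function.Injective q := by
    rw [← LinearMap.ker_eq_bot, LinearMap.ker_eq_bot']
    rintro ⟨⟨v, w⟩, hvw⟩ h
    obtain rfl : w = 0 := h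
    obtain rfl := eq_zero_of_mem_pairSpan hσ.rational hρ.rational hρ.irreducible hy0 hx0 hy hx
      (pairSpan_swap hvw)
    rfl
  have hps : Function.Surjective p := by
    rw [← LinearMap.range_eq_top, eq_top_iff, ← span_orbit_eq_top hρ.irreducible hx0,
      Submodule.span_le]
    rintro _ ⟨g, rfl⟩
    exact ⟨⟨(ρ g x, σ g y), Submodule.subset_span ⟨g, rfl⟩⟩, rfl⟩
  have hqs : Function.Surjective q := by
    rw [← LinearMap.range_eq_top, eq_top_iff, ← span_orbit_eq_top hσ.irreducible hy0,
      Submodule.span_le]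
    rintro _ ⟨g, rfl⟩
    exact ⟨⟨(ρ g x, σ g y), Submodule.subset_span ⟨g, rfl⟩⟩, rfl⟩
  set P := LinearEquiv.ofBijective p ⟨hpi, hps⟩ with hP
  set Q := LinearEquiv.ofBijective q ⟨hqi, hqs⟩ with hQ
  refine ⟨P.symm.trans Q, fun g v => ?_⟩
  obtain ⟨⟨⟨v, w⟩, hvw⟩, rfl⟩ := P.surjective v
  have h1 : ρ g (P ⟨(v, w), hvw⟩) = P ⟨(ρ g v, σ g w), pairSpan_stable g hvw⟩ := rfl
  rw [h1, LinearEquiv.trans_apply, LinearEquiv.trans_apply, LinearEquiv.symm_apply_apply,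
    LinearEquiv.symm_apply_apply]
  rfl

theorem character_eq_of_highestWeight {μ : Fin n → ℚ} (hρ : IsIrrepOfHighestWeight ρ μ)
    (hσ : IsIrrepOfHighestWeight σ μ) (g : SO n) : ρ.character g = σ.character g := by
  obtain ⟨e, he⟩ := exists_equiv_of_highestWeight hρ hσ
  have : σ g = e.conj (ρ g) := by
    ext w
    rw [LinearEquiv.conj_apply_apply, he, LinearEquiv.apply_symm_apply]
  rw [Representation.character, Representation.character, this, LinearMap.trace_conj']

end Uniqueness

/-! ### The middle exterior power and its basis vectors -/

open exteriorPower Filter Topology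

variable {n : ℕ}

/-- The action of a matrix on the middle exterior power. -/
def extMap (M : Matrix (Fin (2 * n)) (Fin (2 * n)) ℂ) :
    ⋀[ℂ]^n (Fin (2 * n) → ℂ) →ₗ[ℂ] ⋀[ℂ]^n (Fin (2 * n) → ℂ) :=
  exteriorPower.map n (Matrix.toLin' M)

theorem exteriorRep_apply (g : SO n) : exteriorRep n n g = extMap (mat g) := rfl

theorem extMap_mul (M N : Matrix (Fin (2 * n)) (Fin (2 * n)) ℂ)
    (x : ⋀[ℂ]^n (Fin (2 * n) → ℂ)) : extMap (M * N) x = extMap M (extMap N x) := by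
  rw [extMap, Matrix.toLin'_mul, exteriorPower.map_comp]
  rfl

theorem extMap_one (x : ⋀[ℂ]^n (Fin (2 * n) → ℂ)) : extMap 1 x = x := by
  rw [extMap, Matrix.toLin'_one, exteriorPower.map_id]
  rfl

theorem extMap_ιMulti (M : Matrix (Fin (2 * n)) (Fin (2 * n)) ℂ)
    (v : Fin n → Fin (2 * n) → ℂ) : extMap M (ιMulti ℂ n v) = ιMulti ℂ n fun k => M *ᵥ v k := by
  rw [extMap, exteriorPower.map_apply_ιMulti]
  rfl

/-- The exterior product of standard basis vectors. -/
def wedge (f : Fin n → Fin (2 * n)) : ⋀[ℂ]^n (Fin (2 * n) → ℂ) :=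
  ιMulti ℂ n fun k => Pi.single (f k) (1 : ℂ)

theorem ιMulti_family_eq_wedge (s : Set.powersetCard (Fin (2 * n)) n) :
    ιMulti_family ℂ n (Pi.basisFun ℂ (Fin (2 * n))) s
      = wedge (Set.powersetCard.ofFinEmbEquiv.symm s) := by
  rw [ιMulti_family, wedge]
  congr 1
  funext k
  rw [Function.comp_apply, Pi.basisFun_apply]

theorem span_range_wedge : Submodule.span ℂ (Set.range (wedge (n := n))) = ⊤ := by
  have h := ιMulti_family_span_of_span ℂ (n := n) (Pi.basisFun ℂ (Fin (2 * n))).span_eq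
  rw [eq_top_iff, ← h, Submodule.span_le]
  rintro _ ⟨s, rfl⟩
  exact Submodule.subset_span ⟨_, (ιMulti_family_eq_wedge s).symm⟩

theorem wedge_eq_zero {f : Fin n → Fin (2 * n)} (hf : ¬ Function.Injective f) : wedge f = 0 := by
  rw [Function.Injective] at hf
  push Not at hf
  obtain ⟨k, l, h, hkl⟩ := hf
  exact AlternatingMap.map_eq_zero_of_eq _ _ (by rw [h]) hkl

theorem wedge_perm (f : Fin n → Fin (2 * n)) (τ : Equiv.Perm (Fin n)) :
    wedge (f ∘ τ) = Equiv.Perm.sign τ • wedge f :=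
  AlternatingMap.map_perm (ιMulti ℂ n)
    (fun k => (Pi.single (f k) (1 : ℂ) : Fin (2 * n) → ℂ)) τ

/-! ### Reflections -/

/-- The reflection exchanging the basis vectors `e_i` and `e_{i'}`, where `i'` is the index
opposite to `i`. -/
def reflPerm (i : Fin (2 * n)) : Equiv.Perm (Fin (2 * n)) := Equiv.swap i (Fin.rev i)

theorem rev_ne (i : Fin (2 * n)) : Fin.rev i ≠ i := by
  intro h
  have := congrArg Fin.val h
  rw [Fin.val_rev] at this
  omega

@[simp]
theorem reflPerm_reflPerm (i a : Fin (2 * n)) : reflPerm i (reflPerm i a) = a :=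
  Equiv.congr_fun (Equiv.swap_swap i (Fin.rev i)) a

theorem reflPerm_rev (i a : Fin (2 * n)) : reflPerm i (Fin.rev a) = Fin.rev (reflPerm i a) := by
  unfold reflPerm
  by_cases h1 : a = i
  · subst h1
    simp
  · by_cases h2 : a = Fin.rev i
    · subst h2
      simp
    · rw [Equiv.swap_apply_of_ne_of_ne h1 h2, Equiv.swap_apply_of_ne_of_ne]
      · intro h
        exact h2 (by rw [← h, Fin.rev_rev])
      · intro h
        exact h1 (Fin.rev_injective h)

theorem reflPerm_self (i : Fin (2 * n)) : reflPerm i i = Fin.rev i := Equiv.swap_apply_left ..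

theorem reflPerm_of_ne {i a : Fin (2 * n)} (h1 : a ≠ i) (h2 : a ≠ Fin.rev i) :
    reflPerm i a = a := Equiv.swap_apply_of_ne_of_ne h1 h2

/-- The matrix of the reflection `reflPerm`. -/
def reflMatrix (i : Fin (2 * n)) : Matrix (Fin (2 * n)) (Fin (2 * n)) ℂ :=
  (reflPerm i).permMatrix ℂ

theorem reflMatrix_apply (i a b : Fin (2 * n)) :
    reflMatrix i a b = if reflPerm i a = b then 1 else 0 := by
  simp [reflMatrix, Equiv.Perm.permMatrix, PEquiv.toMatrix_apply, eq_comm]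

theorem reflMatrix_mul_apply (i : Fin (2 * n)) (M : Matrix (Fin (2 * n)) (Fin (2 * n)) ℂ)
    (a b : Fin (2 * n)) : (reflMatrix i * M) a b = M (reflPerm i a) b := by
  simp [Matrix.mul_apply, reflMatrix_apply]

theorem reflMatrix_transpose (i : Fin (2 * n)) : (reflMatrix i)ᵀ = reflMatrix i := by
  ext a b
  rw [Matrix.transpose_apply, reflMatrix_apply, reflMatrix_apply]
  congr 1
  exact propext ⟨fun h => by rw [← h, reflPerm_reflPerm], fun h => by rw [← h, reflPerm_reflPerm]⟩

theorem reflMatrix_mul_self (i : Fin (2 * n)) : reflMatrix i * reflMatrix i = 1 := by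
  ext a b
  rw [reflMatrix_mul_apply, reflMatrix_apply, reflPerm_reflPerm, Matrix.one_apply]

theorem det_reflMatrix (i : Fin (2 * n)) : (reflMatrix i).det = -1 := by
  rw [reflMatrix, Matrix.det_permutation, reflPerm, Equiv.Perm.sign_swap (rev_ne i).symm]
  simp

theorem reflMatrix_mul_formMatrix_mul (i : Fin (2 * n)) :
    (reflMatrix i)ᵀ * formMatrix n * reflMatrix i = formMatrix n := by
  have h : reflMatrix i * formMatrix n = formMatrix n * reflMatrix i := by
    ext a b
    rw [reflMatrix_mul_apply, formMatrix_mul_apply, reflMatrix_apply, reflPerm_rev]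
    simp only [formMatrix, Matrix.of_apply, eq_comm]
  rw [reflMatrix_transpose, h, Matrix.mul_assoc, reflMatrix_mul_self, Matrix.mul_one]

theorem reflMatrix_mulVec_single (i a : Fin (2 * n)) :
    reflMatrix i *ᵥ Pi.single a (1 : ℂ) = Pi.single (reflPerm i a) 1 := by
  rw [Matrix.mulVec_single_one]
  ext b
  simp only [Matrix.col_apply, reflMatrix_apply, Pi.single_apply]
  congr 1
  exact propext ⟨fun h => by rw [← h, reflPerm_reflPerm], fun h => by rw [h, reflPerm_reflPerm]⟩

theorem extMap_reflMatrix_wedge (i : Fin (2 * n)) (f : Fin n → Fin (2 * n)) :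
    extMap (reflMatrix i) (wedge f) = wedge (reflPerm i ∘ f) := by
  rw [wedge, extMap_ιMulti, wedge]
  simp only [reflMatrix_mulVec_single]
  rfl

theorem extMap_reflMatrix_self (i : Fin (2 * n)) (x : ⋀[ℂ]^n (Fin (2 * n) → ℂ)) :
    extMap (reflMatrix i) (extMap (reflMatrix i) x) = x := by
  rw [← extMap_mul, reflMatrix_mul_self, extMap_one]

/-- The product of two reflections lies in `SO_{2n}`. -/
def reflMulRefl (i j : Fin (2 * n)) : SO n :=
  ofMatrix (reflMatrix i * reflMatrix j)
    (by rw [Matrix.det_mul, det_reflMatrix, det_reflMatrix]; norm_num) (by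
    calc _ = (reflMatrix j)ᵀ * ((reflMatrix i)ᵀ * formMatrix n * reflMatrix i) * reflMatrix j := by
          simp only [Matrix.transpose_mul, Matrix.mul_assoc]
      _ = formMatrix n := by rw [reflMatrix_mul_formMatrix_mul, reflMatrix_mul_formMatrix_mul])

/-- Conjugation by a reflection preserves `SO_{2n}`. -/
def reflConj (i : Fin (2 * n)) (g : SO n) : SO n :=
  ofMatrix (reflMatrix i * mat g * reflMatrix i)
    (by rw [Matrix.det_mul, Matrix.det_mul, det_reflMatrix, det_mat]; norm_num) (by
    calc _ = (reflMatrix i)ᵀ * ((mat g)ᵀ * ((reflMatrix i)ᵀ * formMatrix n * reflMatrix i) * mat g)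
            * reflMatrix i := by simp only [Matrix.transpose_mul, Matrix.mul_assoc]
      _ = formMatrix n := by
        rw [reflMatrix_mul_formMatrix_mul, transpose_mul_formMatrix_mul,
          reflMatrix_mul_formMatrix_mul])

/-- R g = (R g R) R since R² = 1. Hence a reflection, though outside SO_{2n}, carries stable
subspaces to stable subspaces. -/
theorem extMap_reflMatrix_exteriorRep (i : Fin (2 * n)) (g : SO n)
    (x : ⋀[ℂ]^n (Fin (2 * n) → ℂ)) :
    extMap (reflMatrix i) (exteriorRep n n g x)
      = exteriorRep n n (reflConj i g) (extMap (reflMatrix i) x) := by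
  rw [exteriorRep_apply, exteriorRep_apply, ← extMap_mul, ← extMap_mul]
  congr 2
  change _ = (reflMatrix i * mat g * reflMatrix i) * reflMatrix i
  rw [Matrix.mul_assoc _ (reflMatrix i) (reflMatrix i), reflMatrix_mul_self, Matrix.mul_one]

/-! ### The invariant pairing -/

/-- The bilinear form on the middle exterior power for which exterior products of basis vectors are
orthonormal. -/
def wedgePairing : ⋀[ℂ]^n (Fin (2 * n) → ℂ) →ₗ[ℂ] Module.Dual ℂ (⋀[ℂ]^n (Fin (2 * n) → ℂ)) :=
  pairingDual ℂ (Fin (2 * n) → ℂ) n ∘ₗ exteriorPower.map n (Pi.basisFun ℂ (Fin (2 * n))).toDual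

theorem wedgePairing_ιMulti (a b : Fin n → Fin (2 * n) → ℂ) :
    wedgePairing (ιMulti ℂ n a) (ιMulti ℂ n b) = (Matrix.of fun i j => a j ⬝ᵥ b i).det := by
  rw [wedgePairing, LinearMap.comp_apply, exteriorPower.map_apply_ιMulti,
    pairingDual_ιMulti_ιMulti]
  congr 2
  funext i j
  have hs : ∀ (x : Fin (2 * n)) (w : Fin (2 * n) → ℂ),
      (Pi.basisFun ℂ (Fin (2 * n))).toDual (Pi.single x 1) w = w x := fun x w => by
    rw [← Pi.basisFun_apply, Module.Basis.toDual_apply_right, Pi.basisFun_repr]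
  rw [Function.comp_apply, ← Module.Basis.sum_equivFun (Pi.basisFun ℂ (Fin (2 * n))) (a j)]
  simp [hs, dotProduct, Pi.single_apply, map_sum]

/-- On decomposable vectors both sides are determinants of Gram matrices, which agree entrywise
because M and Mᵀ are adjoint for the dot product. -/
theorem wedgePairing_extMap (M : Matrix (Fin (2 * n)) (Fin (2 * n)) ℂ)
    (x y : ⋀[ℂ]^n (Fin (2 * n) → ℂ)) :
    wedgePairing (extMap M x) y = wedgePairing x (extMap Mᵀ y) := by
  have h : wedgePairing ∘ₗ extMap M = (extMap Mᵀ).dualMap ∘ₗ wedgePairing := by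
    refine exteriorPower.linearMap_ext (AlternatingMap.ext fun a => ?_)
    refine exteriorPower.linearMap_ext (AlternatingMap.ext fun b => ?_)
    simp only [LinearMap.compAlternatingMap_apply, LinearMap.comp_apply, LinearMap.dualMap_apply,
      extMap_ιMulti, wedgePairing_ιMulti]
    congr 2
    funext i j
    rw [Matrix.dotProduct_mulVec, Matrix.vecMul_transpose]
  exact LinearMap.congr_fun (LinearMap.congr_fun h x) y

theorem wedgePairing_exteriorRep (g : SO n) (x y : ⋀[ℂ]^n (Fin (2 * n) → ℂ)) :
    wedgePairing (exteriorRep n n g x) y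
      = wedgePairing x (exteriorRep n n (transposeElt g) y) := by
  rw [exteriorRep_apply, wedgePairing_extMap]
  rfl

theorem wedgePairing_family (s : Set.powersetCard (Fin (2 * n)) n) :
    wedgePairing (ιMulti_family ℂ n (Pi.basisFun ℂ (Fin (2 * n))) s)
      = ((Pi.basisFun ℂ (Fin (2 * n))).exteriorPower n).coord s := by
  rw [basis_coord, ιMultiDual, wedgePairing, LinearMap.comp_apply,
    exteriorPower.map_apply_ιMulti_family]
  congr 2
  funext i
  rw [Function.comp_apply, Module.Basis.coe_toDual_self]

theorem eq_zero_of_wedgePairing {y : ⋀[ℂ]^n (Fin (2 * n) → ℂ)}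
    (h : ∀ x, wedgePairing x y = 0) : y = 0 := by
  refine (Module.Basis.forall_coord_eq_zero_iff
    ((Pi.basisFun ℂ (Fin (2 * n))).exteriorPower n)).mp fun s => ?_
  rw [← wedgePairing_family]
  exact h _

theorem wedgePairing_wedge_self {f : Fin n → Fin (2 * n)} (hf : Function.Injective f) :
    wedgePairing (wedge f) (wedge f) = 1 := by
  have h : (Matrix.of fun i j => (Pi.single (f j) (1 : ℂ) : Fin (2 * n) → ℂ) ⬝ᵥ Pi.single (f i) 1)
      = (1 : Matrix (Fin n) (Fin n) ℂ) := by
    ext i j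
    rw [Matrix.of_apply, single_dotProduct, one_mul, Matrix.one_apply, Pi.single_apply]
    simp [hf.eq_iff, eq_comm]
  rw [wedge, wedgePairing_ιMulti, h, Matrix.det_one]

/-! ### Weight vectors -/

/-- After composing with a functional, the form pulls back along the linear combination map to an
alternating m-form on ℂ^m, which is a multiple of the determinant. -/
theorem map_upperTriangular {E F : Type*} [AddCommGroup E] [Module ℂ E] [AddCommGroup F]
    [Module ℂ F] {m : ℕ} (ψ : E [⋀^Fin m]→ₗ[ℂ] F) (v : Fin m → E) (C : Matrix (Fin m) (Fin m) ℂ)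
    (hC : ∀ i j, j < i → C i j = 0) :
    ψ (fun j => ∑ i, C i j • v i) = (∏ i, C i i) • ψ v := by
  rw [← Matrix.det_of_isUpperTriangular (M := C) fun i j h => hC i j h]
  refine eq_of_sub_eq_zero ((Module.forall_dual_apply_eq_zero_iff ℂ _).mp fun φ => ?_)
  rw [map_sub, sub_eq_zero, map_smul, smul_eq_mul]
  have h := AlternatingMap.eq_smul_basis_det (e := Pi.basisFun ℂ (Fin m))
    ((φ.compAlternatingMap ψ).compLinearMap (Fintype.linearCombination ℂ v))
  have h1 := congrArg (fun A => A fun j i => C i j) h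
  simp only [AlternatingMap.compLinearMap_apply, LinearMap.compAlternatingMap_apply,
    AlternatingMap.smul_apply, smul_eq_mul, Fintype.linearCombination_apply,
    Pi.basisFun_det_apply, Pi.basisFun_apply, Pi.single_apply, ite_smul, one_smul, zero_smul,
    Finset.sum_ite_eq', Finset.mem_univ, if_true] at h1
  rw [h1, mul_comm, ← Matrix.det_transpose]
  rfl

/-- The condition `hfb` says that the span of the vectors e_{f j} is b-stable. In the increasing
order of f, b acts on it by a triangular matrix, so only the diagonal matters on the top exterior
power. -/
theorem exteriorRep_wedge_of_strictMono {b : SO n} (hb : IsBorel b) {f : Fin n → Fin (2 * n)}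
    (hf : StrictMono f) (hfb : ∀ a, a ∉ Set.range f → ∀ j, mat b a (f j) = 0) :
    exteriorRep n n b (wedge f) = (∏ i, mat b (f i) (f i)) • wedge f := by
  rw [exteriorRep_apply, wedge, extMap_ιMulti]
  have h : (fun k => mat b *ᵥ Pi.single (f k) (1 : ℂ))
      = fun j => ∑ i, mat b (f i) (f j) • (Pi.single (f i) (1 : ℂ) : Fin (2 * n) → ℂ) := by
    funext j
    ext a
    rw [Matrix.mulVec_single_one, Matrix.col_apply, Finset.sum_apply]
    simp only [Pi.smul_apply, Pi.single_apply, smul_eq_mul, mul_ite, mul_one, mul_zero]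
    by_cases ha : a ∈ Set.range f
    · obtain ⟨i, rfl⟩ := ha
      simp [hf.injective.eq_iff]
    · rw [hfb a ha j, Finset.sum_eq_zero]
      intro i _
      rw [if_neg]
      rintro rfl
      exact ha ⟨i, rfl⟩
  rw [h]
  exact map_upperTriangular (E := Fin (2 * n) → ℂ) (ιMulti ℂ n)
    (fun k => Pi.single (f k) (1 : ℂ)) (fun i j => mat b (f i) (f j))
    fun i j hij => hb _ _ (hf hij)

/-! ### Root elements, opposite pairs and generation of the exterior power -/

theorem single_mul_formMatrix (a b : Fin (2 * n)) :
    Matrix.single a b (1 : ℂ) * formMatrix n = Matrix.single a (Fin.rev b) 1 := by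
  ext i j
  rw [mul_formMatrix_apply, Matrix.single_apply, Matrix.single_apply]
  congr 1
  exact propext (and_congr_right fun _ => ⟨fun h => by rw [h, Fin.rev_rev],
    fun h => by rw [← h, Fin.rev_rev]⟩)

theorem formMatrix_mul_single (a b : Fin (2 * n)) :
    formMatrix n * Matrix.single a b (1 : ℂ) = Matrix.single (Fin.rev a) b 1 := by
  ext i j
  rw [formMatrix_mul_apply, Matrix.single_apply, Matrix.single_apply]
  congr 1
  exact propext (and_congr_left fun _ => ⟨fun h => by rw [h, Fin.rev_rev],
    fun h => by rw [← h, Fin.rev_rev]⟩)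

/-- The root element `1 + E_{i'j} - E_{j'i}` of `SO_{2n}`, where `i'` is opposite to `i`. -/
theorem exists_mat_eq_rootElt {i j : Fin (2 * n)} (hij : j ≠ Fin.rev i) :
    ∃ u : SO n, mat u = 1 + (Matrix.single (Fin.rev i) j 1 - Matrix.single (Fin.rev j) i 1) := by
  set X : Matrix (Fin (2 * n)) (Fin (2 * n)) ℂ :=
    Matrix.single (Fin.rev i) j 1 - Matrix.single (Fin.rev j) i 1 with hX
  have hXX : X * X = 0 := by
    have h1 : i ≠ Fin.rev i := (rev_ne i).symm
    have h2 : j ≠ Fin.rev j := (rev_ne j).symm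
    have h3 : i ≠ Fin.rev j := fun h => hij (by rw [h, Fin.rev_rev])
    simp only [hX, Matrix.sub_mul, Matrix.mul_sub, Matrix.single_mul_single_of_ne _ _ _ _ h1,
      Matrix.single_mul_single_of_ne _ _ _ _ h2, Matrix.single_mul_single_of_ne _ _ _ _ h3,
      Matrix.single_mul_single_of_ne _ _ _ _ hij, sub_zero]
  have hXE : Xᵀ * formMatrix n = -(formMatrix n * X) := by
    simp only [hX, Matrix.transpose_sub, Matrix.transpose_single, Matrix.sub_mul, Matrix.mul_sub,
      single_mul_formMatrix, formMatrix_mul_single, Fin.rev_rev]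
    abel
  have hpres : (1 + X)ᵀ * formMatrix n * (1 + X) = formMatrix n := by
    calc _ = (formMatrix n + Xᵀ * formMatrix n) * (1 + X) := by
          rw [Matrix.transpose_add, Matrix.transpose_one, Matrix.add_mul, Matrix.one_mul]
      _ = formMatrix n - formMatrix n * (X * X) := by rw [hXE]; noncomm_ring
      _ = formMatrix n := by rw [hXX, Matrix.mul_zero, sub_zero]
  have hdet : (1 + (1 + X)).det ≠ 0 := by
    intro h
    -- X² = 0, so (2 + X)(2 - X) = 4.
    have h1 : (1 + (1 + X)) * (1 + 1 - X) = (4 : ℂ) • 1 := by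
      calc _ = (1 + 1 + 1 + 1) - X * X := by noncomm_ring
        _ = (4 : ℂ) • 1 := by rw [hXX, sub_zero]; module
    have h2 := congrArg Matrix.det h1
    rw [Matrix.det_mul, h, zero_mul, Matrix.det_smul, Matrix.det_one, mul_one] at h2
    exact pow_ne_zero _ (by norm_num) h2.symm
  exact ⟨ofMatrix _ (det_eq_one_of_det_one_add_ne_zero hpres hdet) hpres, rfl⟩

/-- The pair `{a, a'}` of opposite indices containing `a`. -/
def pairIndex (a : Fin (2 * n)) : Fin n :=
  if h : a.1 < n then ⟨a.1, h⟩ else ⟨(Fin.rev a).1, by rw [Fin.val_rev]; omega⟩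

theorem pairIndex_firstHalf (m : Fin n) : pairIndex (firstHalf m) = m := by
  simp [pairIndex, firstHalf]

theorem pairIndex_rev (a : Fin (2 * n)) : pairIndex (Fin.rev a) = pairIndex a := by
  have ha := a.2
  have hr := Fin.val_rev a
  unfold pairIndex
  split_ifs <;> simp only [Fin.mk.injEq, Fin.rev_rev] <;> omega

/-- If a family of `n` indices contains an opposite pair, then it misses some opposite pair. -/
theorem exists_firstHalf_notMem_range {f : Fin n → Fin (2 * n)} {k l : Fin n} (hkl : k ≠ l)
    (h : f l = Fin.rev (f k)) :
    ∃ m : Fin n, ∀ a, f a ≠ firstHalf m ∧ f a ≠ Fin.rev (firstHalf m) := by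
  have hinj : ¬ Function.Injective (pairIndex ∘ f) := fun hi =>
    hkl (hi (by simp [h, pairIndex_rev]))
  rw [Finite.injective_iff_surjective, Function.Surjective] at hinj
  push Not at hinj
  obtain ⟨m, hm⟩ := hinj
  refine ⟨m, fun a => ⟨fun ha => hm a ?_, fun ha => hm a ?_⟩⟩
  · rw [Function.comp_apply, ha, pairIndex_firstHalf]
  · rw [Function.comp_apply, ha, pairIndex_rev, pairIndex_firstHalf]

/-- The positions of a family of indices whose opposite index also occurs in the family. -/
def pairedPositions (f : Fin n → Fin (2 * n)) : Finset (Fin n) :=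
  {k | ∃ l, f l = Fin.rev (f k)}

theorem mem_pairedPositions {f : Fin n → Fin (2 * n)} {k : Fin n} :
    k ∈ pairedPositions f ↔ ∃ l, f l = Fin.rev (f k) := by
  simp [pairedPositions]

/-- Drives the descent in `wedge_mem`: when neither new index has its opposite in the new family,
positions k and l become unpaired and no other position becomes paired. -/
theorem pairedPositions_update_ssubset {f : Fin n → Fin (2 * n)} {k l : Fin n} (hkl : k ≠ l)
    (h : f l = Fin.rev (f k)) {a b : Fin (2 * n)}
    (ha : ∀ m, Function.update (Function.update f k a) l b m ≠ Fin.rev a)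
    (hb : ∀ m, Function.update (Function.update f k a) l b m ≠ Fin.rev b) :
    pairedPositions (Function.update (Function.update f k a) l b) ⊂ pairedPositions f := by
  set f' := Function.update (Function.update f k a) l b with hf'
  have hk : f' k = a := by rw [hf', Function.update_of_ne hkl, Function.update_self]
  have hl : f' l = b := by rw [hf', Function.update_self]
  have hm : ∀ m, m ≠ k → m ≠ l → f' m = f m := fun m h1 h2 => by
    rw [hf', Function.update_of_ne h2, Function.update_of_ne h1]
  have hne : ∀ m ∈ pairedPositions f', m ≠ k ∧ m ≠ l := fun m hmem => by
    obtain ⟨p, hp⟩ := mem_pairedPositions.mp hmem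
    refine ⟨?_, ?_⟩
    · rintro rfl
      rw [hk] at hp
      exact ha p hp
    · rintro rfl
      rw [hl] at hp
      exact hb p hp
  refine Finset.ssubset_iff_subset_ne.mpr ⟨fun m hmem => ?_, fun heq => ?_⟩
  · obtain ⟨p, hp⟩ := mem_pairedPositions.mp hmem
    have hpk : p ≠ k := by
      rintro rfl
      rw [hk] at hp
      exact ha m (by rw [hp, Fin.rev_rev])
    have hpl : p ≠ l := by
      rintro rfl
      rw [hl] at hp
      exact hb m (by rw [hp, Fin.rev_rev])
    rw [hm p hpk hpl, hm m (hne m hmem).1 (hne m hmem).2] at hp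
    exact mem_pairedPositions.mpr ⟨p, hp⟩
  · have : k ∈ pairedPositions f' := heq ▸ mem_pairedPositions.mpr ⟨l, h⟩
    exact (hne k this).1 rfl

section Generation

variable {M : Submodule ℂ (⋀[ℂ]^n (Fin (2 * n) → ℂ))}

/-- Without opposite pairs, the reflection at an index of the second half moves only that index,
into the first half. Once none is left, the family is a permutation of the first n indices. -/
theorem wedge_mem_of_pairedPositions_eq_empty
    (hrefl : ∀ i, ∀ v ∈ M, extMap (reflMatrix i) v ∈ M) (h0 : wedge firstHalf ∈ M) :
    ∀ (N : ℕ) (f : Fin n → Fin (2 * n)), Function.Injective f → pairedPositions f = ∅ →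
      (Finset.univ.filter fun k => n ≤ (f k).1).card = N → wedge f ∈ M := by
  intro N
  induction N with
  | zero =>
    intro f hf _ hN
    have hlt : ∀ k, (f k).1 < n := fun k => by
      by_contra hk
      have := Finset.card_eq_zero.mp hN
      have hmem : k ∈ Finset.univ.filter fun k => n ≤ (f k).1 := by simpa using hk
      rw [this] at hmem
      exact absurd hmem (Finset.notMem_empty k)
    let τ : Equiv.Perm (Fin n) := Equiv.ofBijective (fun k => ⟨(f k).1, hlt k⟩)
      (Finite.injective_iff_bijective.mp fun a b hab => hf (Fin.ext (Fin.mk.inj hab)))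
    have hfτ : f = firstHalf ∘ τ := by
      funext k
      exact Fin.ext rfl
    rw [hfτ, wedge_perm, Units.smul_def]
    exact zsmul_mem h0 _
  | succ N ih =>
    intro f hf hp hN
    obtain ⟨k, hk⟩ := Finset.card_pos.mp (show 0 < (Finset.univ.filter fun k =>
      n ≤ (f k).1).card by omega)
    have hkn : n ≤ (f k).1 := (Finset.mem_filter.mp hk).2
    have hother : ∀ m, m ≠ k → reflPerm (f k) (f m) = f m := fun m hm => by
      refine reflPerm_of_ne (fun h => hm (hf h)) fun h => ?_
      have : k ∈ pairedPositions f := mem_pairedPositions.mpr ⟨m, h⟩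
      rw [hp] at this
      exact Finset.notMem_empty k this
    have hself : reflPerm (f k) (f k) = Fin.rev (f k) := reflPerm_self _
    have h1 := ih (reflPerm (f k) ∘ f) ((reflPerm (f k)).injective.comp hf) (by
        rw [Finset.eq_empty_iff_forall_notMem] at hp ⊢
        intro m hm
        obtain ⟨l, hl⟩ := mem_pairedPositions.mp hm
        refine hp m (mem_pairedPositions.mpr ⟨l, ?_⟩)
        rw [Function.comp_apply, Function.comp_apply, ← reflPerm_rev] at hl
        exact (reflPerm (f k)).injective hl) (by
        have : (Finset.univ.filter fun m => n ≤ ((reflPerm (f k) ∘ f) m).1)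
            = (Finset.univ.filter fun m => n ≤ (f m).1).erase k := by
          ext m
          rw [Finset.mem_filter, Finset.mem_erase, Finset.mem_filter, Function.comp_apply]
          by_cases hm : m = k
          · subst hm
            rw [hself, Fin.val_rev]
            have := (f m).2
            simp only [Finset.mem_univ, true_and, ne_eq, not_true_eq_false, false_and, iff_false]
            omega
          · rw [hother m hm]
            simp [hm]
        rw [this, Finset.card_erase_of_mem hk, hN]
        rfl)
    have h2 := hrefl (f k) _ h1
    rwa [← extMap_reflMatrix_wedge, extMap_reflMatrix_self] at h2

/-- An opposite pair e_i ∧ e_{i'} is traded against a missing pair {j, j'}: a root element produces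
e_i ∧ e_{i'} - e_{j'} ∧ e_j modulo wedges with fewer paired positions, and the reflection at j
reverses the sign of the second term, leaving 2 e_i ∧ e_{i'}. -/
theorem wedge_mem (hG : ∀ g, ∀ v ∈ M, exteriorRep n n g v ∈ M)
    (hrefl : ∀ i, ∀ v ∈ M, extMap (reflMatrix i) v ∈ M) (h0 : wedge firstHalf ∈ M) :
    ∀ (N : ℕ) (f : Fin n → Fin (2 * n)), (pairedPositions f).card = N → wedge f ∈ M := by
  intro N
  induction N using Nat.strong_induction_on with
  | _ N ih =>
  intro f hN
  by_cases hf : Function.Injective f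
  swap
  · rw [wedge_eq_zero hf]
    exact M.zero_mem
  by_cases hp : pairedPositions f = ∅
  · exact wedge_mem_of_pairedPositions_eq_empty hrefl h0 _ f hf hp rfl
  obtain ⟨k, hk⟩ := Finset.nonempty_iff_ne_empty.mpr hp
  obtain ⟨l, hl⟩ := mem_pairedPositions.mp hk
  have hkl : k ≠ l := by
    rintro rfl
    exact rev_ne _ hl.symm
  obtain ⟨m, hm⟩ := exists_firstHalf_notMem_range hkl hl
  set i := f k with hi
  set j := firstHalf m with hj
  have hij : i ≠ j := (hm k).1
  have hji : j ≠ Fin.rev i := by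
    rw [← hl]
    exact (hm l).1.symm
  have hij' : i ≠ Fin.rev j := (hm k).2
  -- the wedge with the entries at `k` and `l` replaced
  set G : (Fin (2 * n) → ℂ) → (Fin (2 * n) → ℂ) → ⋀[ℂ]^n (Fin (2 * n) → ℂ) := fun x y =>
    ιMulti ℂ n (Function.update (Function.update (fun a => Pi.single (f a) (1 : ℂ)) k x) l y)
    with hG'
  have hGw : ∀ a b, G (Pi.single a 1) (Pi.single b 1)
      = wedge (Function.update (Function.update f k a) l b) := fun a b => by
    rw [hG', wedge]
    simp only
    congr 1
    funext c
    by_cases hcl : c = l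
    · subst hcl; simp
    · by_cases hck : c = k
      · subst hck; simp [hcl]
      · simp [hcl, hck]
  have hadd1 : ∀ x x' y, G (x + x') y = G x y + G x' y := fun x x' y => by
    simp only [hG', Function.update_comm hkl]
    exact (ιMulti ℂ n).map_update_add _ _ _ _
  have hadd2 : ∀ x y y', G x (y + y') = G x y + G x y' := fun x y y' =>
    (ιMulti ℂ n).map_update_add _ _ _ _
  have hneg1 : ∀ x y, G (-x) y = -G x y := fun x y => by
    simp only [hG', Function.update_comm hkl]
    exact (ιMulti ℂ n).map_update_neg _ _ _
  have hswap : ∀ x y, G y x = -G x y := fun x y => by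
    have h := AlternatingMap.map_swap (ιMulti ℂ n)
      (Function.update (Function.update (fun a => (Pi.single (f a) (1 : ℂ) :
        Fin (2 * n) → ℂ)) k x) l y) hkl
    rw [← h]
    simp only [hG']
    congr 1
    funext c
    by_cases hcl : c = l
    · subst hcl; simp [hkl]
    · by_cases hck : c = k
      · subst hck; simp [hcl]
      · simp [hcl, hck, Equiv.swap_apply_of_ne_of_ne hck hcl]
  have hGext : ∀ (A : Matrix (Fin (2 * n)) (Fin (2 * n)) ℂ) x y,
      (∀ c, c ≠ k → c ≠ l → A *ᵥ Pi.single (f c) 1 = Pi.single (f c) 1) →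
      extMap A (G x y) = G (A *ᵥ x) (A *ᵥ y) := fun A x y hA => by
    simp only [hG', extMap_ιMulti]
    congr 1
    funext c
    by_cases hcl : c = l
    · subst hcl; simp
    · by_cases hck : c = k
      · subst hck; simp [hcl]
      · simp [hcl, hck, hA c hck hcl]
  have hm1 : G (Pi.single i 1) (Pi.single j 1) ∈ M := by
    rw [hGw]
    refine ih _ (hN ▸ Finset.card_lt_card (pairedPositions_update_ssubset hkl hl ?_ ?_)) _ rfl
    · intro c
      by_cases hcl : c = l
      · subst hcl; simpa using hji
      · by_cases hck : c = k
        · subst hck; simpa [hcl] using (rev_ne i).symm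
        · simpa [hcl, hck, ← hl] using fun h => hcl (hf h)
    · intro c
      by_cases hcl : c = l
      · subst hcl; simpa using (rev_ne j).symm
      · by_cases hck : c = k
        · subst hck; simpa [hcl] using hij'
        · simpa [hcl, hck] using (hm c).2
  have hm2 : G (Pi.single (Fin.rev j) 1) (Pi.single (Fin.rev i) 1) ∈ M := by
    rw [hGw]
    refine ih _ (hN ▸ Finset.card_lt_card (pairedPositions_update_ssubset hkl hl ?_ ?_)) _ rfl
    · intro c
      rw [Fin.rev_rev]
      by_cases hcl : c = l
      · subst hcl; simpa using hji.symm
      · by_cases hck : c = k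
        · subst hck; simpa [hcl] using rev_ne j
        · simpa [hcl, hck] using (hm c).1
    · intro c
      rw [Fin.rev_rev]
      by_cases hcl : c = l
      · subst hcl; simpa using rev_ne i
      · by_cases hck : c = k
        · subst hck; simpa [hcl] using hij'.symm
        · simpa [hcl, hck, hi] using fun h => hck (hf h)
  -- This element sends e_i to e_i - e_{j'} and e_j to e_j + e_{i'}, and fixes the other entries of
  -- the wedge. Expanding u(e_i ∧ e_j), the terms in `hm1` and `hm2` are already known.
  obtain ⟨u, hu⟩ := exists_mat_eq_rootElt hji
  have hucol : ∀ c, mat u *ᵥ Pi.single c 1 = Pi.single c 1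
      + ((if c = j then Pi.single (Fin.rev i) 1 else 0)
        - (if c = i then Pi.single (Fin.rev j) 1 else 0)) := fun c => by
    rw [hu, Matrix.add_mulVec, Matrix.sub_mulVec, Matrix.one_mulVec]
    congr 2
    · split_ifs with h
      · subst h; ext a; simp [Matrix.single_apply, Pi.single_apply, eq_comm]
      · ext a; simp [Ne.symm h]
    · split_ifs with h
      · subst h; ext a; simp [Matrix.single_apply, Pi.single_apply, eq_comm]
      · ext a; simp [Ne.symm h]
  have hm3 := hG u _ hm1
  rw [exteriorRep_apply, hGext _ _ _ (fun c hck hcl => by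
      rw [hucol, if_neg (hm c).1, if_neg fun h => hck (hf h), sub_zero, add_zero]),
    hucol, hucol, if_neg hij, if_pos rfl, if_pos rfl, if_neg hij.symm, zero_sub, sub_zero,
    hadd1, hadd2, hneg1, hadd2] at hm3
  have hm4 : G (Pi.single i 1) (Pi.single (Fin.rev i) 1)
      - G (Pi.single (Fin.rev j) 1) (Pi.single j 1) ∈ M := by
    have := M.add_mem (M.sub_mem hm3 hm1) hm2
    convert this using 1
    abel
  have hm5 := hrefl j _ hm4
  have hfix : ∀ c, reflMatrix j *ᵥ Pi.single (f c) (1 : ℂ) = Pi.single (f c) 1 := fun c => by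
    rw [reflMatrix_mulVec_single, reflPerm_of_ne (hm c).1 (hm c).2]
  rw [map_sub, hGext _ _ _ (fun c _ _ => hfix c), hGext _ _ _ (fun c _ _ => hfix c), hi, ← hl,
    hfix, hfix, reflMatrix_mulVec_single, reflMatrix_mulVec_single, reflPerm_rev, reflPerm_self,
    Fin.rev_rev, hswap (Pi.single (Fin.rev j) 1) (Pi.single j 1)] at hm5
  have hwf : G (Pi.single (f k) 1) (Pi.single (f l) 1) = wedge f := by
    rw [hGw, Function.update_eq_self, Function.update_eq_self]
  rw [hi, ← hl] at hm4
  have hm6 := M.add_mem hm4 hm5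
  have hm7 := M.smul_mem (2⁻¹ : ℂ) hm6
  rw [hwf] at hm7
  convert hm7 using 1
  module

/-- A subspace of the middle exterior power that is stable under `SO_{2n}` and the reflections and
contains `e_1 ∧ ⋯ ∧ e_n` is everything. -/
theorem eq_top_of_stable (hG : ∀ g, ∀ v ∈ M, exteriorRep n n g v ∈ M)
    (hrefl : ∀ i, ∀ v ∈ M, extMap (reflMatrix i) v ∈ M) (h0 : wedge firstHalf ∈ M) : M = ⊤ := by
  rw [eq_top_iff, ← span_range_wedge, Submodule.span_le]
  rintro _ ⟨f, rfl⟩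
  exact wedge_mem hG hrefl h0 _ f rfl

end Generation

/-! ### Rationality -/

theorem isRational_exteriorRep (n : ℕ) : IsRational (exteriorRep n n) := by
  intro φ x
  have hx : x ∈ Submodule.span ℂ (Set.range (wedge (n := n))) :=
    span_range_wedge (n := n) ▸ Submodule.mem_top
  induction hx using Submodule.span_induction with
  | mem x hx =>
    obtain ⟨f, rfl⟩ := hx
    -- Multilinear expansion over all index functions r; repeated indices give zero wedges, so
    -- monomials suffice in place of minors.
    refine ⟨∑ r : Fin n → Fin (2 * n), MvPolynomial.C (φ (wedge r)) *
      ∏ k, MvPolynomial.X (r k, f k), fun g => ?_⟩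
    have h : (fun k => mat g *ᵥ Pi.single (f k) (1 : ℂ))
        = fun k => ∑ a, mat g a (f k) • (Pi.single a (1 : ℂ) : Fin (2 * n) → ℂ) := by
      funext k
      ext a
      simp [Pi.single_apply]
    have h2 : ιMulti ℂ n (fun k => mat g *ᵥ Pi.single (f k) (1 : ℂ))
        = ∑ r : Fin n → Fin (2 * n), (∏ k, mat g (r k) (f k)) • wedge r := by
      rw [h, ← AlternatingMap.coe_multilinearMap, MultilinearMap.map_sum]
      exact Finset.sum_congr rfl fun r _ => MultilinearMap.map_smul_univ _ _ _
    rw [exteriorRep_apply, wedge, extMap_ιMulti, h2, map_sum, map_sum]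
    refine Finset.sum_congr rfl fun r _ => ?_
    simp [mul_comm]
  | zero => exact ⟨0, fun g => by simp⟩
  | add x y _ _ hx hy =>
    obtain ⟨P, hP⟩ := hx
    obtain ⟨Q, hQ⟩ := hy
    exact ⟨P + Q, fun g => by rw [map_add, map_add, map_add, hP, hQ]⟩
  | smul c x _ hx =>
    obtain ⟨P, hP⟩ := hx
    exact ⟨MvPolynomial.C c * P, fun g => by
      rw [map_smul, map_smul, hP, map_mul, MvPolynomial.eval_C, smul_eq_mul]⟩

theorem IsRational.subrepresentation {V : Type*} [AddCommGroup V] [Module ℂ V]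
    {ρ : Representation ℂ (SO n) V} (hρ : IsRational ρ) (S : Subrepresentation ρ) :
    IsRational (V := S.toSubmodule) S.toRepresentation := by
  intro φ x
  obtain ⟨ψ, hψ⟩ := LinearMap.exists_extend φ
  obtain ⟨P, hP⟩ := hρ ψ x
  refine ⟨P, fun g => ?_⟩
  rw [← hP, ← hψ]
  rfl

/-! ### The subrepresentation generated by a vector -/

/-- The subrepresentation generated by a vector. -/
def orbitSubrep {V : Type*} [AddCommGroup V] [Module ℂ V] (ρ : Representation ℂ (SO n) V) (x : V) :
    Subrepresentation ρ where
  toSubmodule := Submodule.span ℂ (Set.range fun g => ρ g x)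
  apply_mem_toSubmodule g _ hv := span_orbit_stable g hv

theorem self_mem_orbitSubrep {V : Type*} [AddCommGroup V] [Module ℂ V]
    (ρ : Representation ℂ (SO n) V) (x : V) : x ∈ (orbitSubrep ρ x).toSubmodule :=
  Submodule.subset_span ⟨1, by simp⟩

theorem orbitSubrep_le {V : Type*} [AddCommGroup V] [Module ℂ V]
    {ρ : Representation ℂ (SO n) V} {x : V} {N : Submodule ℂ V}
    (hN : ∀ g, ∀ v ∈ N, ρ g v ∈ N) (hx : x ∈ N) : (orbitSubrep ρ x).toSubmodule ≤ N := by
  rw [orbitSubrep, Submodule.span_le]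
  rintro _ ⟨g, rfl⟩
  exact hN g x hx

/-- A stable subspace containing x contains its whole orbit, so `hmin` is exactly what
irreducibility needs. -/
theorem isIrrepOfHighestWeight_orbitSubrep {V : Type*} [AddCommGroup V] [Module ℂ V]
    [Module.Finite ℂ V] {ρ : Representation ℂ (SO n) V} (hρ : IsRational ρ) {x : V} (hx0 : x ≠ 0)
    {d : Fin n → ℤ} (hx : ∀ b : SO n, IsBorel b → ρ b x = borelCharacter d b • x)
    {μ : Fin n → ℚ} (hμ : ∀ i, (d i : ℚ) = μ i)
    (hmin : ∀ N : Submodule ℂ V, (∀ g, ∀ v ∈ N, ρ g v ∈ N) → N ≤ (orbitSubrep ρ x).toSubmodule →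
      N = ⊥ ∨ x ∈ N) :
    IsIrrepOfHighestWeight (V := (orbitSubrep ρ x).toSubmodule)
      (orbitSubrep ρ x).toRepresentation μ where
  finite := inferInstance
  rational := hρ.subrepresentation _
  irreducible :=
    { exists_pair_ne := ⟨⊥, ⊤, fun h => hx0 (by
        have h1 : (⟨x, self_mem_orbitSubrep ρ x⟩ : (orbitSubrep ρ x).toSubmodule) ∈
            (⊤ : Subrepresentation (orbitSubrep ρ x).toRepresentation).toSubmodule :=
          Submodule.mem_top
        rw [← h] at h1
        exact congrArg Subtype.val ((Submodule.mem_bot ℂ).mp h1))⟩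
      eq_bot_or_eq_top := fun S => by
        have hstab : ∀ g, ∀ v ∈ S.toSubmodule.map (orbitSubrep ρ x).toSubmodule.subtype,
            ρ g v ∈ S.toSubmodule.map (orbitSubrep ρ x).toSubmodule.subtype := by
          rintro g _ ⟨v, hv, rfl⟩
          exact ⟨_, S.apply_mem_toSubmodule g hv, rfl⟩
        rcases hmin _ hstab (Submodule.map_subtype_le _ _) with h | h
        · left
          refine Subrepresentation.toSubmodule_injective ?_
          exact Submodule.map_injective_of_injective (Submodule.injective_subtype _)
            (h.trans (Submodule.map_bot _).symm)
        · right
          refine Subrepresentation.toSubmodule_injective (eq_top_iff.mpr fun v _ => ?_)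
          obtain ⟨w, hw, hwv⟩ := orbitSubrep_le hstab h v.2
          rwa [← Subtype.ext hwv] }
  highest := ⟨d, hμ, ⟨x, self_mem_orbitSubrep ρ x⟩,
    fun h => hx0 (congrArg Subtype.val h), fun b hb => Subtype.ext (hx b hb)⟩

/-! ### The two highest weight vectors of the middle exterior power -/

/-- The last index. -/
def lastIndex (hn : 2 ≤ n) : Fin n := (Fin.last (n - 1)).cast (by omega)

theorem val_lastIndex (hn : 2 ≤ n) : (lastIndex hn).1 = n - 1 := rfl

/-- The highest weight vector `e_1 ∧ ⋯ ∧ e_n`. -/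
def plusVector (n : ℕ) : ⋀[ℂ]^n (Fin (2 * n) → ℂ) := wedge firstHalf

/-- The highest weight vector `e_1 ∧ ⋯ ∧ e_{n-1} ∧ e_{n+1}`. -/
def minusVector (hn : 2 ≤ n) : ⋀[ℂ]^n (Fin (2 * n) → ℂ) :=
  wedge (reflPerm (firstHalf (lastIndex hn)) ∘ firstHalf)

/-- The weight of `e_1 ∧ ⋯ ∧ e_{n-1} ∧ e_{n+1}`. -/
def minusWeight (n : ℕ) (i : Fin n) : ℤ := if i.1 + 1 = n then -1 else 1

theorem firstHalf_strictMono : StrictMono (firstHalf (n := n)) := fun _ _ h => h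

theorem val_reflPerm_firstHalf (hn : 2 ≤ n) (i : Fin n) :
    (reflPerm (firstHalf (lastIndex hn)) (firstHalf i)).1 = if i.1 + 1 = n then n else i.1 := by
  have hi := i.2
  split_ifs with h
  · have : i = lastIndex hn := Fin.ext (by simp only [val_lastIndex]; omega)
    rw [this, reflPerm_self, Fin.val_rev]
    simp only [firstHalf, val_lastIndex]
    omega
  · rw [reflPerm_of_ne]
    · rfl
    · intro h'
      have := congrArg Fin.val h'
      simp only [firstHalf, val_lastIndex] at this
      omega
    · intro h'
      have := congrArg Fin.val h'
      rw [Fin.val_rev] at this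
      simp only [firstHalf, val_lastIndex] at this
      omega

theorem plusVector_highest (b : SO n) (hb : IsBorel b) :
    exteriorRep n n b (plusVector n) = borelCharacter (fun _ => 1) b • plusVector n := by
  rw [plusVector, exteriorRep_wedge_of_strictMono hb firstHalf_strictMono]
  · simp [borelCharacter]
  · intro a ha j
    refine hb _ _ ?_
    have : n ≤ a.1 := by
      by_contra h
      exact ha ⟨⟨a.1, by omega⟩, rfl⟩
    exact Fin.lt_def.mpr (lt_of_lt_of_le j.2 this)

theorem sum_mat_rev_mul_mat (b : SO n) (x y : Fin (2 * n)) :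
    ∑ a, mat b (Fin.rev a) x * mat b a y = formMatrix n x y := by
  rw [← transpose_mul_formMatrix_mul b, Matrix.mul_apply]
  refine Finset.sum_congr rfl fun a _ => ?_
  rw [mul_formMatrix_apply, Matrix.transpose_apply]

/-- By triangularity, the middle 2 × 2 block is itself an upper triangular isometry of a hyperbolic
plane, hence diagonal with inverse entries. This is why x₋ is a Borel eigenvector although its
indices skip n. -/
theorem borel_middle (hn : 2 ≤ n) {b : SO n} (hb : IsBorel b) :
    mat b (Fin.rev (firstHalf (lastIndex hn))) (Fin.rev (firstHalf (lastIndex hn))) *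
      mat b (firstHalf (lastIndex hn)) (firstHalf (lastIndex hn)) = 1 ∧
    mat b (firstHalf (lastIndex hn)) (Fin.rev (firstHalf (lastIndex hn))) = 0 := by
  set p := firstHalf (lastIndex hn) with hp
  have hpv : p.1 = n - 1 := rfl
  have hqv : (Fin.rev p).1 = n := by rw [Fin.val_rev]; omega
  have h1 : mat b (Fin.rev p) (Fin.rev p) * mat b p p = 1 := by
    have h := sum_mat_rev_mul_mat b (Fin.rev p) p
    rw [Finset.sum_eq_single p] at h
    · rw [h]; simp [formMatrix]
    · intro a _ ha
      have hav : a.1 ≠ p.1 := fun h => ha (Fin.ext h)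
      rcases lt_or_gt_of_ne hav with hlt | hgt
      · rw [hb (Fin.rev a) (Fin.rev p) (Fin.rev_lt_rev.mpr hlt), zero_mul]
      · rw [hb a p hgt, mul_zero]
    · simp
  refine ⟨h1, ?_⟩
  have h := sum_mat_rev_mul_mat b (Fin.rev p) (Fin.rev p)
  rw [Finset.sum_eq_add p (Fin.rev p) (rev_ne p).symm] at h
  · have hne : mat b (Fin.rev p) (Fin.rev p) ≠ 0 := left_ne_zero_of_mul (h1 ▸ one_ne_zero)
    rw [Fin.rev_rev] at h
    have hE : formMatrix n (Fin.rev p) (Fin.rev p) = 0 := by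
      simp only [formMatrix, Matrix.of_apply, Fin.rev_rev]
      exact if_neg (rev_ne p)
    rw [hE] at h
    have h3 : mat b (Fin.rev p) (Fin.rev p) * mat b p (Fin.rev p) = 0 := by
      linear_combination h / 2
    exact (mul_eq_zero.mp h3).resolve_left hne
  · intro a _ ha
    have ha1 : a.1 ≠ p.1 := fun h => ha.1 (Fin.ext h)
    have ha2 : a.1 ≠ (Fin.rev p).1 := fun h => ha.2 (Fin.ext h)
    rcases lt_or_gt_of_ne ha1 with hlt | hgt
    · rw [hb (Fin.rev a) (Fin.rev p) (Fin.rev_lt_rev.mpr hlt), zero_mul]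
    · rw [hb a (Fin.rev p) (by rw [Fin.lt_def]; omega), mul_zero]
  · simp
  · simp

theorem minusVector_highest (hn : 2 ≤ n) (b : SO n) (hb : IsBorel b) :
    exteriorRep n n b (minusVector hn) = borelCharacter (minusWeight n) b • minusVector hn := by
  obtain ⟨hmid1, hmid2⟩ := borel_middle hn hb
  set p := firstHalf (lastIndex hn) with hp
  have hpv : p.1 = n - 1 := rfl
  have hval := val_reflPerm_firstHalf hn
  rw [minusVector, exteriorRep_wedge_of_strictMono hb]
  · congr 1
    rw [borelCharacter]
    refine Finset.prod_congr rfl fun i _ => ?_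
    rw [Function.comp_apply, minusWeight]
    split_ifs with h
    · have : i = lastIndex hn := Fin.ext (by simp only [val_lastIndex]; omega)
      rw [this, ← hp, reflPerm_self, zpow_neg_one]
      exact eq_inv_of_mul_eq_one_left hmid1
    · have : reflPerm p (firstHalf i) = firstHalf i := Fin.ext (by rw [hval, if_neg h]; rfl)
      rw [← hp, this, zpow_one]
  · intro i j hij
    rw [Fin.lt_def, Function.comp_apply, Function.comp_apply, hval, hval]
    have := i.2
    have := j.2
    have : i.1 < j.1 := hij
    split_ifs <;> omega
  · intro a ha j
    have hj := j.2
    -- Zero-based, the indices absent from x₋ are n - 1 and those beyond n. Triangularity covers all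
    -- entries except row n - 1, column n, which is `hmid2`.
    have hav : a.1 = n - 1 ∨ n < a.1 := by
      by_contra! hcon
      rcases Nat.lt_or_ge a.1 n with h | h
      · exact ha ⟨⟨a.1, h⟩, Fin.ext (by
          rw [Function.comp_apply, hval, if_neg (show ¬ a.1 + 1 = n by omega)])⟩
      · exact ha ⟨lastIndex hn, Fin.ext (by
          rw [Function.comp_apply, hval, if_pos (show (lastIndex hn).1 + 1 = n by
            simp only [val_lastIndex]; omega)]; omega)⟩
    rcases hav with h | h
    · by_cases hjl : j.1 + 1 = n
      · have hj' : j = lastIndex hn := Fin.ext (by simp only [val_lastIndex]; omega)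
        have ha' : a = p := Fin.ext (by rw [h, hpv])
        rw [hj', ha', Function.comp_apply, ← hp, reflPerm_self, hmid2]
      · refine hb _ _ ?_
        rw [Fin.lt_def, Function.comp_apply, hval, if_neg hjl]
        omega
    · refine hb _ _ ?_
      rw [Fin.lt_def, Function.comp_apply, hval]
      split_ifs <;> omega

/-- The two weights differ by t_n², and t_n = 2 here. The gap between the two growth rates separates
the summands. -/
theorem borelCharacter_dominantElt_plus (hn : 2 ≤ n) :
    borelCharacter (fun _ => 1) (dominantElt n)
      = 4 * borelCharacter (minusWeight n) (dominantElt n) := by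
  have h4 : (4 : ℂ) = ∏ i : Fin n, if i = lastIndex hn then 4 else 1 := by simp
  rw [dominantElt, borelCharacter_torusElt, borelCharacter_torusElt, h4, ← Finset.prod_mul_distrib]
  refine Finset.prod_congr rfl fun i _ => ?_
  rw [minusWeight]
  by_cases h : i.1 + 1 = n
  · have : i = lastIndex hn := Fin.ext (by simp only [val_lastIndex]; omega)
    have h1 : n - i.1 = 1 := by omega
    rw [if_pos this, if_pos h, h1]
    norm_num
  · have : i ≠ lastIndex hn := fun h' => h (by rw [h']; simp only [val_lastIndex]; omega)
    rw [if_neg this, if_neg h, one_mul]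

/-! ### Decomposition of the middle exterior power -/

/-- R_i x₊ = (R_i R_p) x₋ for the middle reflection R_p, and R_i R_p has determinant 1: every
reflection sends x₊ into the orbit of x₋. -/
theorem extMap_reflMatrix_plusVector (hn : 2 ≤ n) (i : Fin (2 * n)) :
    extMap (reflMatrix i) (plusVector n)
      = exteriorRep n n (reflMulRefl i (firstHalf (lastIndex hn))) (minusVector hn) := by
  rw [exteriorRep_apply, reflMulRefl, mat_ofMatrix, extMap_mul, minusVector,
    ← extMap_reflMatrix_wedge, extMap_reflMatrix_self, plusVector]

theorem extMap_reflMatrix_minusVector (hn : 2 ≤ n) (i : Fin (2 * n)) :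
    extMap (reflMatrix i) (minusVector hn)
      = exteriorRep n n (reflMulRefl i (firstHalf (lastIndex hn))) (plusVector n) := by
  rw [exteriorRep_apply, reflMulRefl, mat_ofMatrix, extMap_mul, plusVector,
    extMap_reflMatrix_wedge (firstHalf (lastIndex hn)), minusVector]

/-- The summand generated by `e_1 ∧ ⋯ ∧ e_n`. -/
def plusRep (n : ℕ) : Subrepresentation (exteriorRep n n) :=
  orbitSubrep (exteriorRep n n) (plusVector n)

/-- The summand generated by `e_1 ∧ ⋯ ∧ e_{n-1} ∧ e_{n+1}`. -/
def minusRep (hn : 2 ≤ n) : Subrepresentation (exteriorRep n n) :=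
  orbitSubrep (exteriorRep n n) (minusVector hn)

theorem plusVector_mem : plusVector n ∈ (plusRep n).toSubmodule := self_mem_orbitSubrep _ _

theorem minusVector_mem (hn : 2 ≤ n) : minusVector hn ∈ (minusRep hn).toSubmodule :=
  self_mem_orbitSubrep _ _

theorem extMap_reflMatrix_mem_minusRep (hn : 2 ≤ n) (i : Fin (2 * n))
    {v : ⋀[ℂ]^n (Fin (2 * n) → ℂ)} (hv : v ∈ (plusRep n).toSubmodule) :
    extMap (reflMatrix i) v ∈ (minusRep hn).toSubmodule := by
  have h : (plusRep n).toSubmodule ≤ (minusRep hn).toSubmodule.comap (extMap (reflMatrix i)) := by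
    refine orbitSubrep_le (fun g v hv => ?_) ?_
    · rw [Submodule.mem_comap] at hv ⊢
      rw [extMap_reflMatrix_exteriorRep]
      exact (minusRep hn).apply_mem_toSubmodule _ hv
    · rw [Submodule.mem_comap, extMap_reflMatrix_plusVector hn]
      exact (minusRep hn).apply_mem_toSubmodule _ (minusVector_mem hn)
  exact Submodule.mem_comap.mp (h hv)

theorem extMap_reflMatrix_mem_plusRep (hn : 2 ≤ n) (i : Fin (2 * n))
    {v : ⋀[ℂ]^n (Fin (2 * n) → ℂ)} (hv : v ∈ (minusRep hn).toSubmodule) :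
    extMap (reflMatrix i) v ∈ (plusRep n).toSubmodule := by
  have h : (minusRep hn).toSubmodule ≤ (plusRep n).toSubmodule.comap (extMap (reflMatrix i)) := by
    refine orbitSubrep_le (fun g v hv => ?_) ?_
    · rw [Submodule.mem_comap] at hv ⊢
      rw [extMap_reflMatrix_exteriorRep]
      exact (plusRep n).apply_mem_toSubmodule _ hv
    · rw [Submodule.mem_comap, extMap_reflMatrix_minusVector hn]
      exact (plusRep n).apply_mem_toSubmodule _ plusVector_mem
  exact Submodule.mem_comap.mp (h hv)

theorem plusRep_sup_minusRep (hn : 2 ≤ n) :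
    (plusRep n).toSubmodule ⊔ (minusRep hn).toSubmodule = ⊤ := by
  refine eq_top_of_stable (fun g v hv => ?_) (fun i v hv => ?_)
    (Submodule.mem_sup_left (self_mem_orbitSubrep _ _))
  · exact (plusRep n ⊔ minusRep hn).apply_mem_toSubmodule g hv
  · obtain ⟨a, ha, b, hb, rfl⟩ := Submodule.mem_sup.mp hv
    rw [map_add]
    exact add_mem (Submodule.mem_sup_right (extMap_reflMatrix_mem_minusRep hn i ha))
      (Submodule.mem_sup_left (extMap_reflMatrix_mem_plusRep hn i hb))

theorem wedgePairing_plusVector_dominantElt_pow (k : ℕ) (v : ⋀[ℂ]^n (Fin (2 * n) → ℂ)) :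
    wedgePairing (plusVector n) (exteriorRep n n (dominantElt n ^ k) v)
      = borelCharacter (fun _ => 1) (dominantElt n) ^ k * wedgePairing (plusVector n) v := by
  have ht : transposeElt (dominantElt n ^ k) = dominantElt n ^ k := mat_injective (by
    rw [mat_transposeElt, dominantElt, mat_torusElt_pow, Matrix.diagonal_transpose])
  have h := wedgePairing_exteriorRep (dominantElt n ^ k) (plusVector n) v
  rw [ht, dominantElt_pow_apply plusVector_highest, map_smul, LinearMap.smul_apply,
    smul_eq_mul] at h
  exact h.symm

theorem wedgePairing_plusVector_self : wedgePairing (plusVector n) (plusVector n) = 1 :=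
  wedgePairing_wedge_self firstHalf_strictMono.injective

theorem plusVector_ne_zero : plusVector n ≠ 0 := fun h => by
  have := wedgePairing_plusVector_self (n := n)
  rw [h, map_zero] at this
  exact zero_ne_one this

theorem minusVector_ne_zero (hn : 2 ≤ n) : minusVector hn ≠ 0 := fun h => by
  have := extMap_reflMatrix_self (firstHalf (lastIndex hn)) (plusVector n)
  rw [plusVector, extMap_reflMatrix_wedge, ← minusVector, h, map_zero] at this
  exact plusVector_ne_zero this.symm

/-- On P₋ the coefficients of a^k v are O(χ₋(a)^k), whereas pairing with x₊ multiplies exactly by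
χ₊(a)^k = (4 χ₋(a))^k; so the pairing must vanish. -/
theorem wedgePairing_plusVector_of_mem_minusRep (hn : 2 ≤ n) {v : ⋀[ℂ]^n (Fin (2 * n) → ℂ)}
    (hv : v ∈ (minusRep hn).toSubmodule) : wedgePairing (plusVector n) v = 0 := by
  obtain ⟨c, hc⟩ := exists_tendsto_of_mem_span_orbit (isRational_exteriorRep n)
    (minusVector_highest hn) hv
  have h := hc (wedgePairing (plusVector n))
  simp only [wedgePairing_plusVector_dominantElt_pow, borelCharacter_dominantElt_plus hn] at h
  have h0 := borelCharacter_dominantElt_ne_zero (minusWeight n)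
  have h1 := (tendsto_pow_atTop_nhds_zero_of_norm_lt_one
    (show ‖(4⁻¹ : ℂ)‖ < 1 by norm_num)).mul h
  rw [zero_mul] at h1
  refine tendsto_nhds_unique (tendsto_const_nhds.congr fun k => ?_) h1
  rw [mul_pow, inv_pow]
  field_simp

theorem wedgePairing_minusVector_of_mem_plusRep (hn : 2 ≤ n) {v : ⋀[ℂ]^n (Fin (2 * n) → ℂ)}
    (hv : v ∈ (plusRep n).toSubmodule) : wedgePairing (minusVector hn) v = 0 := by
  rw [minusVector, ← extMap_reflMatrix_wedge, wedgePairing_extMap, reflMatrix_transpose]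
  exact wedgePairing_plusVector_of_mem_minusRep hn (extMap_reflMatrix_mem_minusRep hn _ hv)

/-- If x₊ is not in N, a functional vanishing on N but not at x₊ shows that the limit coefficient of
each v in N is 0. This coefficient is the pairing with x₊, so by invariance N is orthogonal to P₊.
It is also orthogonal to P₋, and the pairing is nondegenerate. -/
theorem eq_bot_or_plusVector_mem (hn : 2 ≤ n) (N : Submodule ℂ (⋀[ℂ]^n (Fin (2 * n) → ℂ)))
    (hN : ∀ g, ∀ v ∈ N, exteriorRep n n g v ∈ N) (hle : N ≤ (plusRep n).toSubmodule) :
    N = ⊥ ∨ plusVector n ∈ N := by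
  by_cases hmem : plusVector n ∈ N
  · exact Or.inr hmem
  left
  obtain ⟨φ, hφ, hφN⟩ := N.exists_dual_map_eq_bot_of_notMem hmem inferInstance
  have hφ0 : ∀ v ∈ N, φ v = 0 := fun v hv => by
    have : φ v ∈ N.map φ := Submodule.mem_map_of_mem hv
    rwa [hφN, Submodule.mem_bot] at this
  have hplus : ∀ v ∈ N, wedgePairing (plusVector n) v = 0 := by
    intro v hv
    obtain ⟨c, hc⟩ := exists_tendsto_of_mem_span_orbit (isRational_exteriorRep n)
      plusVector_highest (hle hv)
    have h1 := hc φ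
    simp only [hφ0 _ (hN _ v hv), mul_zero] at h1
    have hc0 : c = 0 := (mul_eq_zero.mp
      (tendsto_nhds_unique tendsto_const_nhds h1).symm).resolve_right hφ
    have h2 := hc (wedgePairing (plusVector n))
    simp only [wedgePairing_plusVector_dominantElt_pow, ← mul_assoc,
      inv_mul_cancel₀ (pow_ne_zero _ (borelCharacter_dominantElt_ne_zero (n := n) fun _ => 1)),
      one_mul, hc0, zero_mul] at h2
    exact tendsto_nhds_unique tendsto_const_nhds h2
  rw [eq_bot_iff]
  intro v hv
  rw [Submodule.mem_bot]
  refine eq_zero_of_wedgePairing fun x => ?_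
  have hx : x ∈ (plusRep n).toSubmodule ⊔ (minusRep hn).toSubmodule :=
    plusRep_sup_minusRep hn ▸ Submodule.mem_top
  suffices h : (plusRep n).toSubmodule ⊔ (minusRep hn).toSubmodule ≤
      LinearMap.ker (wedgePairing.flip v) by simpa using h hx
  refine sup_le ?_ ?_
  · rw [plusRep, orbitSubrep, Submodule.span_le]
    rintro _ ⟨g, rfl⟩
    simp only [SetLike.mem_coe, LinearMap.mem_ker, LinearMap.flip_apply, wedgePairing_exteriorRep]
    exact hplus _ (hN _ v hv)
  · rw [minusRep, orbitSubrep, Submodule.span_le]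
    rintro _ ⟨g, rfl⟩
    simp only [SetLike.mem_coe, LinearMap.mem_ker, LinearMap.flip_apply, wedgePairing_exteriorRep]
    exact wedgePairing_minusVector_of_mem_plusRep hn (hle (hN _ v hv))

theorem eq_bot_or_minusVector_mem (hn : 2 ≤ n) (N : Submodule ℂ (⋀[ℂ]^n (Fin (2 * n) → ℂ)))
    (hN : ∀ g, ∀ v ∈ N, exteriorRep n n g v ∈ N) (hle : N ≤ (minusRep hn).toSubmodule) :
    N = ⊥ ∨ minusVector hn ∈ N := by
  set p := firstHalf (lastIndex hn) with hp
  rcases eq_bot_or_plusVector_mem hn (N.comap (extMap (reflMatrix p)))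
    (fun g v hv => by
      rw [Submodule.mem_comap, extMap_reflMatrix_exteriorRep]
      exact hN _ _ hv)
    (fun v hv => by
      rw [← extMap_reflMatrix_self p v]
      exact extMap_reflMatrix_mem_plusRep hn p (hle hv)) with h | h
  · left
    rw [eq_bot_iff]
    intro v hv
    have : extMap (reflMatrix p) v ∈ N.comap (extMap (reflMatrix p)) := by
      rwa [Submodule.mem_comap, extMap_reflMatrix_self]
    rw [h, Submodule.mem_bot] at this
    rw [Submodule.mem_bot, ← extMap_reflMatrix_self p v, this, map_zero]
  · right
    rw [Submodule.mem_comap, plusVector, extMap_reflMatrix_wedge] at h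
    exact h

theorem isCompl_plusRep_minusRep (hn : 2 ≤ n) :
    IsCompl (plusRep n).toSubmodule (minusRep hn).toSubmodule := by
  refine ⟨disjoint_iff.mpr ?_, codisjoint_iff.mpr (plusRep_sup_minusRep hn)⟩
  refine (eq_bot_or_plusVector_mem hn _
    (fun g v hv => (plusRep n ⊓ minusRep hn).apply_mem_toSubmodule g hv)
    inf_le_left).resolve_right fun h => ?_
  have := wedgePairing_plusVector_of_mem_minusRep hn h.2
  rw [wedgePairing_plusVector_self] at this
  exact one_ne_zero this

theorem isIrrepOfHighestWeight_plusRep (hn : 2 ≤ n) {j : Fin n} (hj : j.1 + 1 = n) :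
    IsIrrepOfHighestWeight (V := (plusRep n).toSubmodule) (plusRep n).toRepresentation
      ((2 : ℚ) • fundamentalWeight n j) := by
  refine isIrrepOfHighestWeight_orbitSubrep (isRational_exteriorRep n) plusVector_ne_zero
    plusVector_highest (fun i => ?_) (eq_bot_or_plusVector_mem hn)
  simp [fundamentalWeight, hj]

theorem isIrrepOfHighestWeight_minusRep (hn : 2 ≤ n) {j : Fin n} (hj : j.1 + 2 = n) :
    IsIrrepOfHighestWeight (V := (minusRep hn).toSubmodule) (minusRep hn).toRepresentation
      ((2 : ℚ) • fundamentalWeight n j) := by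
  refine isIrrepOfHighestWeight_orbitSubrep (isRational_exteriorRep n) (minusVector_ne_zero hn)
    (minusVector_highest hn) (fun i => ?_) (eq_bot_or_minusVector_mem hn)
  have h1 : ¬ j.1 + 1 = n := by omega
  simp only [minusWeight, fundamentalWeight, Pi.smul_apply, h1, hj, if_false, if_true, smul_eq_mul]
  split_ifs <;> norm_num

/-! ### The difference of the two characters -/

theorem trace_eq_sum_wedgePairing (f : Module.End ℂ (⋀[ℂ]^n (Fin (2 * n) → ℂ))) :
    LinearMap.trace ℂ _ f = ∑ s : Set.powersetCard (Fin (2 * n)) n,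
      wedgePairing (wedge (Set.powersetCard.ofFinEmbEquiv.symm s))
        (f (wedge (Set.powersetCard.ofFinEmbEquiv.symm s))) := by
  rw [LinearMap.trace_eq_matrix_trace ℂ ((Pi.basisFun ℂ (Fin (2 * n))).exteriorPower n),
    Matrix.trace]
  refine Finset.sum_congr rfl fun s _ => ?_
  rw [Matrix.diag_apply, LinearMap.toMatrix_apply, exteriorPower.basis_apply,
    ← ιMulti_family_eq_wedge, wedgePairing_family]
  rfl

theorem exteriorRep_torusElt_wedge (t : Fin n → ℂˣ) (f : Fin n → Fin (2 * n)) :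
    exteriorRep n n (torusElt t) (wedge f) = (∏ k, (torusEntry t (f k) : ℂ)) • wedge f := by
  have h : (fun k => mat (torusElt t) *ᵥ Pi.single (f k) (1 : ℂ))
      = fun k => (torusEntry t (f k) : ℂ) • (Pi.single (f k) (1 : ℂ) : Fin (2 * n) → ℂ) := by
    funext k
    ext a
    rw [mat_torusElt, Matrix.mulVec_diagonal, Pi.smul_apply, smul_eq_mul, Pi.single_apply]
    split_ifs with h
    · rw [h]
    · rw [mul_zero, mul_zero]
  rw [exteriorRep_apply, wedge, extMap_ιMulti, h, ← AlternatingMap.coe_multilinearMap,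
    MultilinearMap.map_smul_univ]

theorem wedgePairing_exteriorRep_torusElt (t : Fin n → ℂˣ) (f : Fin n → Fin (2 * n))
    (x : ⋀[ℂ]^n (Fin (2 * n) → ℂ)) :
    wedgePairing (wedge f) (exteriorRep n n (torusElt t) x)
      = (∏ k, (torusEntry t (f k) : ℂ)) * wedgePairing (wedge f) x := by
  have ht : transposeElt (torusElt t) = torusElt t := mat_injective (by
    rw [mat_transposeElt, mat_torusElt, Matrix.diagonal_transpose])
  rw [← ht, ← wedgePairing_exteriorRep, exteriorRep_torusElt_wedge, map_smul,
    LinearMap.smul_apply, smul_eq_mul]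

/-- The involution of the middle exterior power that is `1` on the first summand and `-1` on the
second one. -/
def summandSign (hn : 2 ≤ n) : Module.End ℂ (⋀[ℂ]^n (Fin (2 * n) → ℂ)) :=
  (2 : ℂ) • ((plusRep n).toSubmodule.subtype ∘ₗ
    (plusRep n).toSubmodule.projectionOnto _ (isCompl_plusRep_minusRep hn)) - LinearMap.id

theorem summandSign_of_mem_plusRep (hn : 2 ≤ n) {v : ⋀[ℂ]^n (Fin (2 * n) → ℂ)}
    (hv : v ∈ (plusRep n).toSubmodule) : summandSign hn v = v := by
  have h := Submodule.projectionOnto_apply_left (isCompl_plusRep_minusRep hn) ⟨v, hv⟩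
  simp only at h
  rw [summandSign, LinearMap.sub_apply, LinearMap.smul_apply, LinearMap.comp_apply, h,
    Submodule.subtype_apply, LinearMap.id_apply]
  module

theorem summandSign_of_mem_minusRep (hn : 2 ≤ n) {v : ⋀[ℂ]^n (Fin (2 * n) → ℂ)}
    (hv : v ∈ (minusRep hn).toSubmodule) : summandSign hn v = -v := by
  have h := Submodule.projectionOnto_apply_right (isCompl_plusRep_minusRep hn) ⟨v, hv⟩
  simp only at h
  rw [summandSign, LinearMap.sub_apply, LinearMap.smul_apply, LinearMap.comp_apply, h, map_zero,
    smul_zero, LinearMap.id_apply, zero_sub]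

/-- Reflections interchange the eigenspaces P₊ and P₋ of the involution, hence anticommute with it.
-/
theorem summandSign_extMap_reflMatrix (hn : 2 ≤ n) (i : Fin (2 * n))
    (v : ⋀[ℂ]^n (Fin (2 * n) → ℂ)) :
    summandSign hn (extMap (reflMatrix i) v) = -extMap (reflMatrix i) (summandSign hn v) := by
  obtain ⟨a, ha, b, hb, rfl⟩ := Submodule.mem_sup.mp
    (show v ∈ (plusRep n).toSubmodule ⊔ (minusRep hn).toSubmodule from
      plusRep_sup_minusRep hn ▸ Submodule.mem_top)
  rw [map_add, map_add, map_add, map_add, summandSign_of_mem_plusRep hn ha,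
    summandSign_of_mem_minusRep hn hb,
    summandSign_of_mem_minusRep hn (extMap_reflMatrix_mem_minusRep hn i ha),
    summandSign_of_mem_plusRep hn (extMap_reflMatrix_mem_plusRep hn i hb), map_neg]
  abel

theorem trace_eq_sub_of_isCompl {E : Type*} [AddCommGroup E] [Module ℂ E] [Module.Finite ℂ E]
    {p q : Submodule ℂ E} (h : IsCompl p q) {f : Module.End ℂ E} {a : Module.End ℂ p}
    {b : Module.End ℂ q} (ha : ∀ v : p, f v = a v) (hb : ∀ v : q, f v = -(b v : E)) :
    LinearMap.trace ℂ E f = LinearMap.trace ℂ p a - LinearMap.trace ℂ q b := by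
  have hf : f = p.subtype ∘ₗ (a ∘ₗ p.projectionOnto q h)
      - q.subtype ∘ₗ (b ∘ₗ q.projectionOnto p h.symm) := by
    refine LinearMap.ext fun v => ?_
    obtain ⟨x, hx, y, hy, rfl⟩ := Submodule.mem_sup.mp
      (show v ∈ p ⊔ q from h.sup_eq_top ▸ Submodule.mem_top)
    have h1 := Submodule.projectionOnto_apply_left h ⟨x, hx⟩
    have h2 := Submodule.projectionOnto_apply_right h ⟨y, hy⟩
    have h3 := Submodule.projectionOnto_apply_left h.symm ⟨y, hy⟩
    have h4 := Submodule.projectionOnto_apply_right h.symm ⟨x, hx⟩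
    simp only at h1 h2 h3 h4
    simp only [LinearMap.sub_apply, LinearMap.comp_apply, map_add, h1, h2, h3, h4, map_zero,
      sub_zero, zero_sub, Submodule.subtype_apply]
    rw [← ha ⟨x, hx⟩, ← hb ⟨y, hy⟩]
  have hp : (a ∘ₗ p.projectionOnto q h) ∘ₗ p.subtype = a := LinearMap.ext fun v => by
    rw [LinearMap.comp_apply, LinearMap.comp_apply, Submodule.subtype_apply,
      Submodule.projectionOnto_apply_left]
  have hq : (b ∘ₗ q.projectionOnto p h.symm) ∘ₗ q.subtype = b := LinearMap.ext fun v => by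
    rw [LinearMap.comp_apply, LinearMap.comp_apply, Submodule.subtype_apply,
      Submodule.projectionOnto_apply_left]
  rw [hf, map_sub, LinearMap.trace_comp_comm' _ p.subtype, LinearMap.trace_comp_comm' _ q.subtype,
    hp, hq]

theorem character_sub_eq_trace (hn : 2 ≤ n) (g : SO n) :
    Representation.character (V := (plusRep n).toSubmodule) (plusRep n).toRepresentation g
      - Representation.character (V := (minusRep hn).toSubmodule) (minusRep hn).toRepresentation g
      = LinearMap.trace ℂ _ (exteriorRep n n g ∘ₗ summandSign hn) := by
  refine (trace_eq_sub_of_isCompl (isCompl_plusRep_minusRep hn) (fun v => ?_) fun v => ?_).symm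
  · rw [LinearMap.comp_apply, summandSign_of_mem_plusRep hn v.2]
    rfl
  · rw [LinearMap.comp_apply, summandSign_of_mem_minusRep hn v.2, map_neg]
    rfl

/-- The reflection at the missing pair fixes e_f, is self-adjoint and anticommutes with the sign
operator, so this diagonal entry equals its own negative. -/
theorem wedgePairing_summandSign_eq_zero (hn : 2 ≤ n) {f : Fin n → Fin (2 * n)} {m : Fin n}
    (hm : ∀ k, f k ≠ firstHalf m ∧ f k ≠ Fin.rev (firstHalf m)) :
    wedgePairing (wedge f) (summandSign hn (wedge f)) = 0 := by
  have hf : extMap (reflMatrix (firstHalf m)) (wedge f) = wedge f := by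
    rw [extMap_reflMatrix_wedge]
    congr 1
    funext k
    exact reflPerm_of_ne (hm k).1 (hm k).2
  have h : wedgePairing (wedge f) (summandSign hn (wedge f))
      = -wedgePairing (wedge f) (summandSign hn (wedge f)) := by
    nth_rewrite 2 [← hf]
    rw [summandSign_extMap_reflMatrix, map_neg]
    conv_lhs => rw [← reflMatrix_transpose, ← wedgePairing_extMap, hf]
  linear_combination h / 2

/-- The choice of one index from each opposite pair that takes the second one exactly at the
positions in `U`. -/
def transversal (U : Finset (Fin n)) (k : Fin n) : Fin (2 * n) :=
  if k ∈ U then Fin.rev (firstHalf k) else firstHalf k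

theorem pairIndex_transversal (U : Finset (Fin n)) (k : Fin n) :
    pairIndex (transversal U k) = k := by
  rw [transversal]
  split_ifs
  · rw [pairIndex_rev, pairIndex_firstHalf]
  · rw [pairIndex_firstHalf]

theorem transversal_injective (U : Finset (Fin n)) : Function.Injective (transversal U) :=
  Function.LeftInverse.injective (pairIndex_transversal U)

/-- Each element of U costs one reflection starting from x₊, and each reflection changes the sign of
the eigenvalue. -/
theorem summandSign_wedge_transversal (hn : 2 ≤ n) (U : Finset (Fin n)) :
    summandSign hn (wedge (transversal U)) = (-1 : ℂ) ^ U.card • wedge (transversal U) := by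
  induction U using Finset.induction_on with
  | empty =>
    have h : wedge (transversal ∅) = plusVector n := by
      rw [plusVector]
      congr 1
    rw [h, summandSign_of_mem_plusRep hn plusVector_mem, Finset.card_empty, pow_zero, one_smul]
  | insert a U ha ih =>
    have h : wedge (transversal (insert a U))
        = extMap (reflMatrix (firstHalf a)) (wedge (transversal U)) := by
      rw [extMap_reflMatrix_wedge]
      congr 1
      funext k
      rw [Function.comp_apply]
      by_cases hk : k = a
      · subst hk
        rw [transversal, transversal, if_pos (Finset.mem_insert_self _ _), if_neg ha,
          reflPerm_self]
      · have hp := pairIndex_transversal U k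
        rw [reflPerm_of_ne]
        · simp [transversal, hk]
        · intro h
          rw [h, pairIndex_firstHalf] at hp
          exact hk hp.symm
        · intro h
          rw [h, pairIndex_rev, pairIndex_firstHalf] at hp
          exact hk hp.symm
    rw [h, summandSign_extMap_reflMatrix, ih, map_smul, Finset.card_insert_of_notMem ha, pow_succ]
    module

theorem exists_perm_of_range_subset {α : Type*} {f g : Fin n → α} (hf : Function.Injective f)
    (h : ∀ k, f k ∈ Set.range g) : ∃ τ : Equiv.Perm (Fin n), f = g ∘ τ := by
  choose τ hτ using h
  have hτi : Function.Injective τ := fun a b hab => hf (by rw [← hτ a, ← hτ b, hab])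
  exact ⟨Equiv.ofBijective τ (Finite.injective_iff_bijective.mp hτi), funext fun k => (hτ k).symm⟩

theorem wedgePairing_summandSign_transversal_comp (hn : 2 ≤ n) (U : Finset (Fin n))
    (τ : Equiv.Perm (Fin n)) :
    wedgePairing (wedge (transversal U ∘ τ)) (summandSign hn (wedge (transversal U ∘ τ)))
      = (-1) ^ U.card := by
  have h : summandSign hn (wedge (transversal U ∘ τ))
      = (-1 : ℂ) ^ U.card • wedge (transversal U ∘ τ) := by
    rw [wedge_perm, Units.smul_def, map_zsmul, summandSign_wedge_transversal, smul_comm]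
  rw [h, map_smul, wedgePairing_wedge_self ((transversal_injective U).comp τ.injective),
    smul_eq_mul, mul_one]

/-- The set of values of a transversal. -/
def transversalSet (U : Finset (Fin n)) : Set.powersetCard (Fin (2 * n)) n :=
  ⟨Finset.univ.image (transversal U), by
    rw [Set.powersetCard.mem_iff, Finset.card_image_of_injective _ (transversal_injective U),
      Finset.card_fin]⟩

theorem mem_transversalSet {U : Finset (Fin n)} {a : Fin (2 * n)} :
    a ∈ transversalSet U ↔ a ∈ Set.range (transversal U) := by
  rw [← Set.powersetCard.mem_coe_iff, transversalSet]
  simp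

theorem mem_iff_rev_firstHalf_mem (U : Finset (Fin n)) (k : Fin n) :
    k ∈ U ↔ Fin.rev (firstHalf k) ∈ transversalSet U := by
  rw [mem_transversalSet]
  constructor
  · intro h
    exact ⟨k, if_pos h⟩
  · rintro ⟨l, hl⟩
    have hp := pairIndex_transversal U l
    rw [hl, pairIndex_rev, pairIndex_firstHalf] at hp
    subst hp
    by_contra hk
    rw [transversal, if_neg hk] at hl
    exact rev_ne _ hl.symm

theorem transversalSet_injective : Function.Injective (transversalSet (n := n)) := by
  intro U W h
  ext k
  rw [mem_iff_rev_firstHalf_mem, mem_iff_rev_firstHalf_mem, h]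

/-- A set meeting every opposite pair contains a transversal, and equals it because both have n
elements. -/
theorem exists_missing_pair {s : Set.powersetCard (Fin (2 * n)) n}
    (hs : s ∉ Set.range (transversalSet (n := n))) :
    ∃ m : Fin n, firstHalf m ∉ s ∧ Fin.rev (firstHalf m) ∉ s := by
  classical
  by_contra! hcon
  refine hs ⟨Finset.univ.filter fun k => firstHalf k ∉ s, ?_⟩
  rw [Set.powersetCard.eq_iff_subset]
  intro a ha
  obtain ⟨k, rfl⟩ := mem_transversalSet.mp ha
  rw [transversal]
  split_ifs with h
  · exact hcon k (Finset.mem_filter.mp h).2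
  · by_contra hk
    exact h (Finset.mem_filter.mpr ⟨Finset.mem_univ k, hk⟩)

/-- The difference of the characters of the two summands of the middle exterior power. -/
theorem character_plusRep_sub_character_minusRep (hn : 2 ≤ n) (t : Fin n → ℂˣ) :
    Representation.character (V := (plusRep n).toSubmodule) (plusRep n).toRepresentation
        (torusElt t)
      - Representation.character (V := (minusRep hn).toSubmodule) (minusRep hn).toRepresentation
        (torusElt t)
      = ∏ i, ((t i : ℂ) - (t i : ℂ)⁻¹) := by
  rw [character_sub_eq_trace, trace_eq_sum_wedgePairing]
  simp only [LinearMap.comp_apply, wedgePairing_exteriorRep_torusElt]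
  -- Here U is the set of factors from which -t_i⁻¹ is taken; it will match the transversal that
  -- uses the second index exactly on U.
  have hprod : ∏ i, ((t i : ℂ) - (t i : ℂ)⁻¹) = ∑ U : Finset (Fin n),
      (∏ i ∈ U, -(t i : ℂ)⁻¹) * ∏ i ∈ Uᶜ, (t i : ℂ) := by
    rw [← Fintype.prod_add]
    exact Finset.prod_congr rfl fun i _ => by ring
  rw [hprod]
  symm
  refine Fintype.sum_of_injective transversalSet transversalSet_injective _ _ ?_ ?_
  · intro s hs
    obtain ⟨m, hm1, hm2⟩ := exists_missing_pair hs
    have hmem : ∀ k, Set.powersetCard.ofFinEmbEquiv.symm s k ∈ s := fun k =>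
      (Set.powersetCard.mem_range_ofFinEmbEquiv_symm_iff_mem s _).mp ⟨k, rfl⟩
    rw [wedgePairing_summandSign_eq_zero hn (m := m), mul_zero]
    exact fun k => ⟨fun h => hm1 (h ▸ hmem k), fun h => hm2 (h ▸ hmem k)⟩
  · intro U
    -- The basis lists indices increasingly, the transversal by pairs. The sign of the permutation τ
    -- enters the diagonal entry twice and disappears.
    obtain ⟨τ, hτ⟩ := exists_perm_of_range_subset
      (f := Set.powersetCard.ofFinEmbEquiv.symm (transversalSet U)) (g := transversal U)
      (Set.powersetCard.ofFinEmbEquiv.symm (transversalSet U)).injective fun k =>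
        mem_transversalSet.mp
          ((Set.powersetCard.mem_range_ofFinEmbEquiv_symm_iff_mem _ _).mp ⟨k, rfl⟩)
    rw [hτ, wedgePairing_summandSign_transversal_comp]
    have h1 : ∏ k, (torusEntry t ((transversal U ∘ τ) k) : ℂ)
        = ∏ k, (torusEntry t (transversal U k) : ℂ) :=
      Equiv.prod_comp τ fun k => (torusEntry t (transversal U k) : ℂ)
    have h2 : ∀ k, (torusEntry t (transversal U k) : ℂ)
        = if k ∈ U then (t k : ℂ)⁻¹ else (t k : ℂ) := by
      intro k
      rw [transversal]
      split_ifs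
      · have h := torusEntry_mul_rev t (firstHalf k)
        rw [torusEntry_firstHalf] at h
        rw [← Units.val_inv_eq_inv_val]
        congr 1
        exact (inv_eq_of_mul_eq_one_right h).symm
      · rw [torusEntry_firstHalf]
    rw [h1, Finset.prod_congr rfl fun k _ => h2 k, Finset.prod_ite, Finset.prod_neg]
    have h3 : Finset.univ.filter (fun k => k ∈ U) = U := by ext; simp
    have h4 : Finset.univ.filter (fun k => k ∉ U) = Uᶜ := by ext; simp
    rw [h3, h4]
    ring

end SOEven

end

/-! ### The theorem -/

open SOEven
theorem lemma6p6 (n : ℕ) (hn : 2 ≤ n) :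
    (∀ (V : Type u) [AddCommGroup V] [Module ℂ V] (W : Type v) [AddCommGroup W] [Module ℂ W]
        (ρ : Representation ℂ (SO n) V) (σ : Representation ℂ (SO n) W),
        IsIrrepOfHighestWeight ρ ((2 : ℚ) • fundamentalWeight n ⟨n - 1, by omega⟩) →
        IsIrrepOfHighestWeight σ ((2 : ℚ) • fundamentalWeight n ⟨n - 2, by omega⟩) →
        ∀ t : Fin n → ℂˣ,
          ρ.character (torusElt t) - σ.character (torusElt t) =
            ∏ i, ((t i : ℂ) - (t i : ℂ)⁻¹)) ∧
    (∃ V₁ V₂ : Subrepresentation (exteriorRep n n),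
        IsCompl V₁.toSubmodule V₂.toSubmodule ∧
        IsIrrepOfHighestWeight (V := V₁.toSubmodule) V₁.toRepresentation
          ((2 : ℚ) • fundamentalWeight n ⟨n - 1, by omega⟩) ∧
        IsIrrepOfHighestWeight (V := V₂.toSubmodule) V₂.toRepresentation
          ((2 : ℚ) • fundamentalWeight n ⟨n - 2, by omega⟩)) := by
  have hplus := isIrrepOfHighestWeight_plusRep hn (j := ⟨n - 1, by omega⟩) (Nat.sub_add_cancel
    (one_le_two.trans hn))
  have hminus := isIrrepOfHighestWeight_minusRep hn (j := ⟨n - 2, by omega⟩) (Nat.sub_add_cancel hn)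
  refine ⟨fun V _ _ W _ _ ρ σ hρ hσ t => ?_, plusRep n, minusRep hn, isCompl_plusRep_minusRep hn,
    hplus, hminus⟩
  -- By uniqueness, the characters of arbitrary models are those of the two summands of the exterior
  -- power.
  rw [character_eq_of_highestWeight hρ hplus, character_eq_of_highestWeight hσ hminus,
    character_plusRep_sub_character_minusRep]
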